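/- Let $\mathbb{O}\cong\mathbb{R}^8$ be the octonions, let $S^7\subset\mathbb{O}$ and $S^6\subset\operatorname{Im}\mathbb{O}\cong\mathbb{R}^7$ be the unit spheres, and let $P_0(u,v)=(u,-v)$ and $P_1(u,v)=(v,u)$ on $\mathbb{R}^{16}=\mathbb{R}^8\oplus\mathbb{R}^8$. Let $$M_+=\{x\in S^{15}\subset\mathbb{R}^{16} : |x|^4-2\langle P_0x,x\rangle^2-2\langle P_1x,x\rangle^2=1\}.$$ Let $J$ be the endomorphism of the tangent bundle of $S^1\times M_+\subset\mathbb{C}\times\mathbb{R}^{16}$ given at $(a,x)$ by $J\varepsilon=\eta$, $J\eta=-\varepsilon$, where $\varepsilon=\sqrt{-1}\,a\in T_aS^1$ and $\eta=P_0P_1x\in T_xM_+$, and $JX=P_0P_1X$ for $X\in T_xM_+$ with $\langle X,\eta\rangle=0$. Then: 1. The map $\psi(y,z)=\frac{1}{\sqrt2}(y,zy)$, with octonion multiplication, is a diffeomorphism from $S^7\times S^6$ onto $M_+$; that is, $\psi:S^7\times S^6\to\mathbb{R}^{16}$ is a smooth embedding with image $M_+$. 2. $S^1\times S^7\times S^6$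 admits a complex structure: there is an atlas of charts with values in $\mathbb{C}^7$, compatible with the standard smooth structure of $S^1\times S^7\times S^6$, whose transition maps are holomorphic. The atlas can be chosen so that the almost complex structure which it induces is the pullback of $J$ under the diffeomorphism $\mathrm{id}\times\psi: S^1\times S^7\times S^6\to S^1\times M_+$. -/

import Mathlib

open scoped Manifold ContDiff RealInnerProductSpace Quaternion

noncomputable section

/-! ### Complex structures on smooth manifolds -/

/-- A complex structure of complex dimension `n` on the smooth manifold `M`: an atlas of charts
with values in `ℂⁿ` whose transition maps are holomorphic and which defines the given smooth
structure of `M` (each chart is a diffeomorphism from its source onto its target; the topology is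
the given one). -/
structure ComplexStructure {E H : Type*} [NormedAddCommGroup E] [NormedSpace ℝ E]
    [TopologicalSpace H] (I : ModelWithCorners ℝ E H) (M : Type*) [TopologicalSpace M]
    [ChartedSpace H M] (n : ℕ) extends ChartedSpace (EuclideanSpace ℂ (Fin n)) M where
  holomorphic :
    IsManifold 𝓘(ℂ, EuclideanSpace ℂ (Fin n)) ω M
  smooth_chart : ∀ e ∈ atlas,
    ContMDiffOn I 𝓘(ℝ, EuclideanSpace ℂ (Fin n)) ∞ e e.source
  smooth_chart_symm : ∀ e ∈ atlas,
    ContMDiffOn 𝓘(ℝ, EuclideanSpace ℂ (Fin n)) I ∞ e.symm e.target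

/-- The endomorphism `J` of the tangent bundle is the almost complex structure induced by the
holomorphic coordinates of `C`: in every chart `e` of `C`, `de (J v) = i • de v`. -/
def ComplexStructure.Induces {E H : Type*} [NormedAddCommGroup E] [NormedSpace ℝ E]
    [TopologicalSpace H] {I : ModelWithCorners ℝ E H} {M : Type*} [TopologicalSpace M]
    [ChartedSpace H M] {n : ℕ} (C : ComplexStructure I M n)
    (J : ∀ p : M, TangentSpace I p →L[ℝ] TangentSpace I p) : Prop :=
  ∀ e ∈ C.atlas, ∀ p ∈ e.source,
    let de : TangentSpace I p →L[ℝ] EuclideanSpace ℂ (Fin n) :=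
      mfderiv I 𝓘(ℝ, EuclideanSpace ℂ (Fin n)) e p
    ∀ v : TangentSpace I p, de (J p v) = Complex.I • de v

/-! ### Spheres and octonions -/

/-- The unit sphere `S⁷` in `ℝ⁸ = 𝕆`. -/
abbrev S7 : Type := Metric.sphere (0 : EuclideanSpace ℝ (Fin 8)) 1

/-- The unit sphere `S⁶` in `ℝ⁷ = Im 𝕆`. -/
abbrev S6 : Type := Metric.sphere (0 : EuclideanSpace ℝ (Fin 7)) 1

/-- `S¹ × S⁷ × S⁶`. -/
abbrev N14 : Type := Circle × S7 × S6

/-- The model with corners of `S⁷ × S⁶` with its standard smooth structure. -/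
abbrev modelS7S6 := (𝓡 7).prod (𝓡 6)

/-- The model with corners of `S¹ × S⁷ × S⁶` with its standard smooth structure. -/
abbrev modelN14 := (𝓡 1).prod modelS7S6

/-- The quaternion formed by the first four coordinates of an octonion. -/
def octFst (x : EuclideanSpace ℝ (Fin 8)) : ℍ[ℝ] := ⟨x 0, x 1, x 2, x 3⟩

/-- The quaternion formed by the last four coordinates of an octonion. -/
def octSnd (x : EuclideanSpace ℝ (Fin 8)) : ℍ[ℝ] := ⟨x 4, x 5, x 6, x 7⟩

/-- The octonion `(a, b)` with quaternionic parts `a` and `b`. -/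
def octMk (a b : ℍ[ℝ]) : EuclideanSpace ℝ (Fin 8) :=
  !₂[a.re, a.imI, a.imJ, a.imK, b.re, b.imI, b.imJ, b.imK]

/-- Octonion multiplication on `ℝ⁸ = ℍ ⊕ ℍ`, by the Cayley-Dickson construction
`(a, b) (c, d) = (a c - d̄ b, d a + b c̄)`. -/
def octMul (x y : EuclideanSpace ℝ (Fin 8)) : EuclideanSpace ℝ (Fin 8) :=
  octMk (octFst x * octFst y - star (octSnd y) * octSnd x)
    (octSnd y * octFst x + octSnd x * star (octFst y))

/-- The inclusion of `ℝ⁷ = Im 𝕆` in `𝕆 = ℝ⁸`. -/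
def octIm (z : EuclideanSpace ℝ (Fin 7)) : EuclideanSpace ℝ (Fin 8) :=
  !₂[0, z 0, z 1, z 2, z 3, z 4, z 5, z 6]

/-! ### The focal submanifold -/

/-- `ℝ¹⁶ = ℝ⁸ ⊕ ℝ⁸` with its Euclidean inner product. -/
abbrev R16 : Type := WithLp 2 (EuclideanSpace ℝ (Fin 8) × EuclideanSpace ℝ (Fin 8))

/-- The Clifford matrix `P₀ (u, v) = (u, -v)`. -/
def cliffP0 (x : R16) : R16 := WithLp.toLp 2 (x.fst, -x.snd)

/-- The Clifford matrix `P₁ (u, v) = (v, u)`. -/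
def cliffP1 (x : R16) : R16 := WithLp.toLp 2 (x.snd, x.fst)

/-- The polynomial `F(x) = |x|⁴ - 2 (⟨P₀ x, x⟩² + ⟨P₁ x, x⟩²)`. -/
def fkmF (x : R16) : ℝ :=
  ‖x‖ ^ 4 - 2 * (⟪cliffP0 x, x⟫ ^ 2 + ⟪cliffP1 x, x⟫ ^ 2)

/-- The focal submanifold `M₊ = {x ∈ S¹⁵ | F(x) = 1}`, of dimension 13. -/
def MPlus : Set R16 := {x | ‖x‖ = 1 ∧ fkmF x = 1}

/-- The vector field `η(x) = P₀ P₁ x`, a unit tangent field on `M₊`. -/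
def etaField (x : R16) : R16 := cliffP0 (cliffP1 x)

/-- The vector field `ε(a) = i a`, a unit tangent field on `S¹ ⊆ ℂ`. -/
def epsField (a : ℂ) : ℂ := Complex.I * a

/-- The endomorphism `J` of `T_(a, x) (S¹ × M₊) ⊆ ℂ × ℝ¹⁶` with `J ε = η`, `J η = -ε` and
`J X = P₀ P₁ X` for `X ∈ T_x M₊` orthogonal to `η`. A tangent vector `(c, X)` is decomposed as
`⟨c, ε⟩ ε + ⟨X, η⟩ η + (X - ⟨X, η⟩ η)`. -/
def focalJ (q w : ℂ × R16) : ℂ × R16 :=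
  (-(⟪w.2, etaField q.2⟫ • epsField q.1),
    ⟪w.1, epsField q.1⟫ • etaField q.2 +
      cliffP0 (cliffP1 (w.2 - ⟪w.2, etaField q.2⟫ • etaField q.2)))

/-- The map `ψ (y, z) = (y, z y) / √2` from `S⁷ × S⁶` to `ℝ¹⁶`, with octonion multiplication. -/
def psiMap (p : S7 × S6) : R16 :=
  (1 / Real.sqrt 2) • WithLp.toLp 2 ((p.1 : EuclideanSpace ℝ (Fin 8)), octMul (octIm p.2) p.1)

/-- The map `Ψ = id × ψ` from `S¹ × S⁷ × S⁶` to `ℂ × ℝ¹⁶`. -/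
def bigPsi (p : N14) : ℂ × R16 := ((p.1 : ℂ), psiMap p.2)

end

noncomputable section

/-! Write a point of `ℝ¹⁶` as `(u, v)`. On the unit sphere, `F = 1` says that a sum of two squares
vanishes, so `M₊` is cut out by `|u| = |v|` and `u ⊥ v` (`mem_MPlus_iff`). Left multiplication by an
imaginary octonion `z` sends `y` to a vector orthogonal to `y` of norm `|z||y|`; conversely, for `u
⊥ v` with `u ≠ 0`, the octonion `v ū` is imaginary and `(v ū) u = |u|² v` (`octMul_octQuot`). This
gives the image of `ψ` and a left inverse `psiInv` that is smooth near `M₊`, so `dψ` is injective.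
Compactness makes `ψ` a topological embedding, and the inverse function theorem turns injectivity of
`dψ` into the local normal form of an immersion.

For the complex structure, `w = u - i v` identifies `ℝ¹⁶` with `ℂ⁸` and `P₀ P₁` with multiplication
by `i`. The conditions `|u| = |v|`, `u ⊥ v` become the single equation `∑ wⱼ² = 0`
(`sum_toCplx_sq_eq_zero_iff`). The cone without its vertex is thus a complex manifold of dimension
7, and `(t, x) ↦ eᵗ x` identifies it with `ℝ × M₊`. Reducing `t` modulo `2π` divides the cone by the
holomorphic map `w ↦ e^(2π) w`, so holomorphic coordinates of the cone descend to `S¹ × M₊`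
(`contDiffOn_coneChart_transition`).

The quotient map is `polarMap`. It sends the radial direction `x` to `ε` and `i x` to `η`, and it
only rescales vectors orthogonal to both. Hence it carries multiplication by `i` to `J`
(`fderiv_polarMap_etaField`). -/

/-! ### Octonion multiplication in coordinates -/

lemma inner_eight (x y : EuclideanSpace ℝ (Fin 8)) :
    ⟪x, y⟫ = x 0 * y 0 + x 1 * y 1 + x 2 * y 2 + x 3 * y 3 + x 4 * y 4 + x 5 * y 5 + x 6 * y 6 +
      x 7 * y 7 := by
  simp [PiLp.inner_apply, Fin.sum_univ_eight, mul_comm]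

lemma norm_sq_eight (x : EuclideanSpace ℝ (Fin 8)) :
    ‖x‖ ^ 2 = x 0 ^ 2 + x 1 ^ 2 + x 2 ^ 2 + x 3 ^ 2 + x 4 ^ 2 + x 5 ^ 2 + x 6 ^ 2 + x 7 ^ 2 := by
  simp [EuclideanSpace.norm_sq_eq, Fin.sum_univ_eight]

lemma norm_sq_seven (x : EuclideanSpace ℝ (Fin 7)) :
    ‖x‖ ^ 2 = x 0 ^ 2 + x 1 ^ 2 + x 2 ^ 2 + x 3 ^ 2 + x 4 ^ 2 + x 5 ^ 2 + x 6 ^ 2 := by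
  simp [EuclideanSpace.norm_sq_eq, Fin.sum_univ_seven]

/-- With the product expanded, the octonion facts below become polynomial identities for `ring`, and
no alternativity law is needed. -/
lemma octMul_octIm_apply (z : EuclideanSpace ℝ (Fin 7)) (y : EuclideanSpace ℝ (Fin 8)) :
    octMul (octIm z) y =
      !₂[-(z 0 * y 1) - z 1 * y 2 - z 2 * y 3 - z 3 * y 4 - z 4 * y 5 - z 5 * y 6 - z 6 * y 7,
        z 0 * y 0 + z 1 * y 3 - z 2 * y 2 + z 3 * y 5 - z 4 * y 4 - z 5 * y 7 + z 6 * y 6,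
        -(z 0 * y 3) + z 1 * y 0 + z 2 * y 1 + z 3 * y 6 + z 4 * y 7 - z 5 * y 4 - z 6 * y 5,
        z 0 * y 2 - z 1 * y 1 + z 2 * y 0 + z 3 * y 7 - z 4 * y 6 + z 5 * y 5 - z 6 * y 4,
        -(z 0 * y 5) - z 1 * y 6 - z 2 * y 7 + z 3 * y 0 + z 4 * y 1 + z 5 * y 2 + z 6 * y 3,
        z 0 * y 4 - z 1 * y 7 + z 2 * y 6 - z 3 * y 1 + z 4 * y 0 - z 5 * y 3 + z 6 * y 2,
        z 0 * y 7 + z 1 * y 4 - z 2 * y 5 - z 3 * y 2 + z 4 * y 3 + z 5 * y 0 - z 6 * y 1,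
        -(z 0 * y 6) + z 1 * y 5 + z 2 * y 4 - z 3 * y 3 - z 4 * y 2 + z 5 * y 1 + z 6 * y 0] := by
  ext i
  fin_cases i <;>
    simp [octMul, octMk, Quaternion.re_mul, Quaternion.imI_mul, Quaternion.imJ_mul,
      Quaternion.imK_mul, Quaternion.re_star, Quaternion.imI_star, Quaternion.imJ_star,
      Quaternion.imK_star] <;>
    simp [octIm, octFst, octSnd] <;> ring

lemma inner_octMul_octIm (z : EuclideanSpace ℝ (Fin 7)) (y : EuclideanSpace ℝ (Fin 8)) :
    ⟪y, octMul (octIm z) y⟫ = 0 := by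
  simp [inner_eight, octMul_octIm_apply]
  ring

lemma norm_octMul_octIm (z : EuclideanSpace ℝ (Fin 7)) (y : EuclideanSpace ℝ (Fin 8)) :
    ‖octMul (octIm z) y‖ = ‖z‖ * ‖y‖ := by
  rw [← sq_eq_sq₀ (norm_nonneg _) (by positivity), mul_pow, norm_sq_eight, norm_sq_eight,
    norm_sq_seven]
  simp [octMul_octIm_apply]
  ring

/-- The imaginary part of `v ū`, for octonions `u` and `v`. -/
def octQuot (u v : EuclideanSpace ℝ (Fin 8)) : EuclideanSpace ℝ (Fin 7) :=
  WithLp.toLp 2 fun k ↦ ⟪octMul (octIm (EuclideanSpace.single k 1)) u, v⟫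

lemma octQuot_octMul_octIm (z : EuclideanSpace ℝ (Fin 7)) (y : EuclideanSpace ℝ (Fin 8)) :
    octQuot y (octMul (octIm z) y) = ‖y‖ ^ 2 • z := by
  ext i
  fin_cases i <;> simp [octQuot, inner_eight, norm_sq_eight, octMul_octIm_apply] <;> ring

/-- Since `v ū = ⟪u, v⟫ + Im (v ū)` and `(v ū) u = |u|² v`, the imaginary part alone gives `|u|² v -
⟪u, v⟫ u`; orthogonality removes the correction. -/
lemma octMul_octQuot {u v : EuclideanSpace ℝ (Fin 8)} (h : ⟪u, v⟫ = 0) :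
    octMul (octIm (octQuot u v)) u = ‖u‖ ^ 2 • v := by
  have key : octMul (octIm (octQuot u v)) u = ‖u‖ ^ 2 • v - ⟪u, v⟫ • u := by
    ext i
    fin_cases i <;> simp [octQuot, inner_eight, norm_sq_eight, octMul_octIm_apply] <;> ring
  rw [key, h, zero_smul, sub_zero]

lemma norm_octQuot {u v : EuclideanSpace ℝ (Fin 8)} (h : ⟪u, v⟫ = 0) (hu : u ≠ 0) :
    ‖octQuot u v‖ = ‖u‖ * ‖v‖ := by
  have h0 : ‖u‖ ≠ 0 := norm_ne_zero_iff.2 hu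
  have h1 := congrArg norm (octMul_octQuot h)
  rw [norm_octMul_octIm, norm_smul, norm_pow, norm_norm] at h1
  apply mul_right_cancel₀ h0
  rw [h1]; ring

lemma octMul_octIm_smul_smul (c d : ℝ) (z : EuclideanSpace ℝ (Fin 7))
    (y : EuclideanSpace ℝ (Fin 8)) :
    octMul (octIm (c • z)) (d • y) = (c * d) • octMul (octIm z) y := by
  ext i
  fin_cases i <;> simp [octMul_octIm_apply] <;> ring

lemma octQuot_smul_right (u v : EuclideanSpace ℝ (Fin 8)) (c : ℝ) :
    octQuot u (c • v) = c • octQuot u v := by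
  ext i
  simp [octQuot, inner_smul_right]

lemma octQuot_smul_left (u v : EuclideanSpace ℝ (Fin 8)) (c : ℝ) :
    octQuot (c • u) v = c • octQuot u v := by
  ext i
  have := octMul_octIm_smul_smul 1 c (EuclideanSpace.single i 1) u
  rw [one_smul, one_mul] at this
  simp [octQuot, inner_smul_left, this]

/-! ### The map `ψ`, its left inverse and its image -/

/-- Radial projection to the unit sphere, with value `b` at the origin. -/
def sphereProj {E : Type*} [NormedAddCommGroup E] [NormedSpace ℝ E]
    (b : Metric.sphere (0 : E) 1) (x : E) : Metric.sphere (0 : E) 1 :=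
  open Classical in
  if h : x = 0 then b else ⟨‖x‖⁻¹ • x, by simp [norm_smul, norm_ne_zero_iff.2 h]⟩

lemma coe_sphereProj {E : Type*} [NormedAddCommGroup E] [NormedSpace ℝ E]
    (b : Metric.sphere (0 : E) 1) {x : E} (hx : x ≠ 0) : (sphereProj b x : E) = ‖x‖⁻¹ • x := by
  simp [sphereProj, hx]

lemma sphereProj_smul_coe {E : Type*} [NormedAddCommGroup E] [NormedSpace ℝ E]
    (b y : Metric.sphere (0 : E) 1) {c : ℝ} (hc : 0 < c) : sphereProj b (c • (y : E)) = y := by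
  have hy : ‖(y : E)‖ = 1 := by simp
  have hy0 : (y : E) ≠ 0 := by intro h; simp [h] at hy
  apply Subtype.ext
  rw [coe_sphereProj b (smul_ne_zero hc.ne' hy0), norm_smul, hy, smul_smul, mul_one,
    Real.norm_of_nonneg hc.le, inv_mul_cancel₀ hc.ne', one_smul]

/-- A base point of the sphere `Sⁿ`. -/
def sphereBase (n : ℕ) : Metric.sphere (0 : EuclideanSpace ℝ (Fin (n + 1))) 1 :=
  ⟨EuclideanSpace.single 0 1, by simp⟩

/-- The map `(u, v) ↦ (u, v ū)`, up to positive factors: a left inverse of `ψ`. -/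
def psiInv (x : R16) : S7 × S6 :=
  (sphereProj (sphereBase 7) x.fst, sphereProj (sphereBase 6) (octQuot x.fst x.snd))

lemma psiMap_fst (p : S7 × S6) :
    (psiMap p).fst = (1 / Real.sqrt 2) • (p.1 : EuclideanSpace ℝ (Fin 8)) := by
  simp [psiMap]

lemma psiMap_snd (p : S7 × S6) :
    (psiMap p).snd =
      (1 / Real.sqrt 2) • octMul (octIm p.2) (p.1 : EuclideanSpace ℝ (Fin 8)) := by
  simp [psiMap]

/-- The factor `c` is there for the points `eᵗ ψ(y, z)` of the cone. It scales `u` by `c` and `v ū`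
by `c²`, and radial projection discards both. -/
lemma psiInv_smul_psiMap {c : ℝ} (hc : 0 < c) (p : S7 × S6) : psiInv (c • psiMap p) = p := by
  have h2 : 0 < 1 / Real.sqrt 2 := by positivity
  have h3 : ‖(p.1 : EuclideanSpace ℝ (Fin 8))‖ = 1 := by simp
  refine Prod.ext ?_ ?_
  · change sphereProj _ (c • psiMap p).fst = _
    rw [WithLp.smul_fst, psiMap_fst, smul_smul]
    exact sphereProj_smul_coe _ _ (mul_pos hc h2)
  · change sphereProj _ (octQuot (c • psiMap p).fst (c • psiMap p).snd) = _
    rw [WithLp.smul_fst, psiMap_fst, WithLp.smul_snd, psiMap_snd, smul_smul, smul_smul,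
      octQuot_smul_left, octQuot_smul_right, octQuot_octMul_octIm, h3, one_pow, one_smul, smul_smul]
    exact sphereProj_smul_coe _ _ (mul_pos (mul_pos hc h2) (mul_pos hc h2))

lemma psiInv_psiMap (p : S7 × S6) : psiInv (psiMap p) = p := by
  simpa using psiInv_smul_psiMap one_pos p

lemma psiMap_psiInv {x : R16} (hx : x ≠ 0) (hn : ‖x.fst‖ = ‖x.snd‖) (ho : ⟪x.fst, x.snd⟫ = 0) :
    psiMap (psiInv x) = ‖x‖⁻¹ • x := by
  have hx2 := WithLp.prod_norm_sq_eq_of_L2 x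
  have hu : ‖x.fst‖ ≠ 0 := by
    intro h
    rw [← hn, h] at hx2
    exact hx (by simpa using hx2)
  have hu0 := norm_ne_zero_iff.1 hu
  have hq : octQuot x.fst x.snd ≠ 0 := by
    rw [← norm_ne_zero_iff, norm_octQuot ho hu0, ← hn]
    exact mul_ne_zero hu hu
  have hnx : ‖x‖ = Real.sqrt 2 * ‖x.fst‖ := by
    rw [← sq_eq_sq₀ (norm_nonneg _) (by positivity), hx2, ← hn, mul_pow, Real.sq_sqrt two_pos.le]
    ring
  have h2 : Real.sqrt 2 ≠ 0 := by positivity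
  have e1 : ((psiInv x).1 : EuclideanSpace ℝ (Fin 8)) = ‖x.fst‖⁻¹ • x.fst := coe_sphereProj _ hu0
  have e2 : ((psiInv x).2 : EuclideanSpace ℝ (Fin 7)) =
      ‖octQuot x.fst x.snd‖⁻¹ • octQuot x.fst x.snd := coe_sphereProj _ hq
  have e3 : (psiMap (psiInv x)).fst = (‖x‖⁻¹ • x).fst := by
    rw [psiMap_fst, e1, smul_smul, WithLp.smul_fst, hnx]
    congr 1
    field_simp
  have e4 : (psiMap (psiInv x)).snd = (‖x‖⁻¹ • x).snd := by
    rw [psiMap_snd, e1, e2, octMul_octIm_smul_smul, octMul_octQuot ho, smul_smul, smul_smul,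
      WithLp.smul_snd, hnx, norm_octQuot ho hu0, ← hn]
    congr 1
    field_simp
  exact (WithLp.ofLp_injective 2) (Prod.ext e3 e4)

lemma norm_psiMap_fst (p : S7 × S6) : ‖(psiMap p).fst‖ = 1 / Real.sqrt 2 := by
  rw [psiMap_fst, norm_smul, Real.norm_of_nonneg (by positivity)]
  simp

lemma norm_psiMap_snd (p : S7 × S6) : ‖(psiMap p).snd‖ = 1 / Real.sqrt 2 := by
  rw [psiMap_snd, norm_smul, norm_octMul_octIm, Real.norm_of_nonneg (by positivity)]
  simp

lemma inner_psiMap_fst_snd (p : S7 × S6) : ⟪(psiMap p).fst, (psiMap p).snd⟫ = 0 := by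
  rw [psiMap_fst, psiMap_snd, inner_smul_left, inner_smul_right, inner_octMul_octIm]
  simp

lemma norm_psiMap (p : S7 × S6) : ‖psiMap p‖ = 1 := by
  rw [← sq_eq_sq₀ (norm_nonneg _) zero_le_one, WithLp.prod_norm_sq_eq_of_L2, norm_psiMap_fst,
    norm_psiMap_snd, div_pow, Real.sq_sqrt two_pos.le]
  norm_num

lemma mem_MPlus_iff {x : R16} :
    x ∈ MPlus ↔ ‖x‖ = 1 ∧ ‖x.fst‖ = ‖x.snd‖ ∧ ⟪x.fst, x.snd⟫ = 0 := by
  have h0 : ⟪cliffP0 x, x⟫ = ‖x.fst‖ ^ 2 - ‖x.snd‖ ^ 2 := by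
    simp [cliffP0, WithLp.prod_inner_apply, sub_eq_add_neg]
  have h1 : ⟪cliffP1 x, x⟫ = 2 * ⟪x.fst, x.snd⟫ := by
    simp [cliffP1, WithLp.prod_inner_apply, real_inner_comm, two_mul]
  simp only [MPlus, Set.mem_ofPred_eq, fkmF, h0, h1]
  refine and_congr_right fun hx ↦ ?_
  rw [hx]
  constructor
  · intro h
    have a1 : ‖x.fst‖ ^ 2 - ‖x.snd‖ ^ 2 = 0 := by
      apply pow_eq_zero_iff two_ne_zero |>.1
      nlinarith [sq_nonneg (‖x.fst‖ ^ 2 - ‖x.snd‖ ^ 2), sq_nonneg (2 * ⟪x.fst, x.snd⟫)]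
    refine ⟨?_, ?_⟩
    · rw [← sq_eq_sq₀ (norm_nonneg _) (norm_nonneg _)]
      linarith
    · apply pow_eq_zero_iff two_ne_zero |>.1
      rw [a1] at h
      nlinarith
  · rintro ⟨h, h'⟩
    rw [h, h']
    norm_num

lemma range_psiMap : Set.range psiMap = MPlus := by
  ext x
  rw [mem_MPlus_iff]
  constructor
  · rintro ⟨p, rfl⟩
    exact ⟨norm_psiMap p, by rw [norm_psiMap_fst, norm_psiMap_snd], inner_psiMap_fst_snd p⟩
  · rintro ⟨h1, h2, h3⟩
    refine ⟨psiInv x, ?_⟩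
    rw [psiMap_psiInv _ h2 h3, h1, inv_one, one_smul]
    intro h
    simp [h] at h1

/-! ### Smoothness of `ψ` and of its left inverse -/

section Sphere
variable {E : Type*} [NormedAddCommGroup E] [InnerProductSpace ℝ E]
  {F H M : Type*} [NormedAddCommGroup F] [NormedSpace ℝ F] [TopologicalSpace H]
  {I : ModelWithCorners ℝ F H} [TopologicalSpace M] [ChartedSpace H M]

/-- A map to the unit sphere is smooth at a point if it is smooth there as a map to the ambient
space. -/
lemma contMDiffAt_sphere_of_coe {m : ℕ∞ω} {n : ℕ} [Fact (Module.finrank ℝ E = n + 1)]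
    {f : M → Metric.sphere (0 : E) 1} {x : M}
    (hf : ContMDiffAt I 𝓘(ℝ, E) m (fun y ↦ (f y : E)) x) : ContMDiffAt I (𝓡 n) m f x := by
  rw [contMDiffAt_iff_target]
  refine ⟨Topology.IsInducing.subtypeVal.continuousAt_iff.2 hf.continuousAt, ?_⟩
  let U : _ ≃ₗᵢ[ℝ] _ := (OrthonormalBasis.fromOrthogonalSpanSingleton (𝕜 := ℝ) n
    (ne_zero_of_mem_unit_sphere (-(f x)))).repr
  -- The sphere chart at `f x` projects from `-f x`. Its formula is smooth in the ambient space
  -- where `⟪-f x, ·⟫ ≠ 1`, and at `f x` this inner product is `-1`.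
  have h1 : ContDiffAt ℝ m (U ∘ stereoToFun (-(f x : E))) (f x : E) := by
    refine U.contDiff.contDiffAt.comp _ ?_
    refine contDiffOn_stereoToFun.contDiffAt ?_
    refine IsOpen.mem_nhds (isOpen_ne_fun (by fun_prop) (by fun_prop)) ?_
    simp [innerSL_apply_apply]
    norm_num
  exact ContMDiffAt.comp (g := U ∘ stereoToFun (-(f x : E))) (f := fun y ↦ (f y : E)) x
    h1.contMDiffAt hf

end Sphere

lemma contMDiffAt_sphereProj {n : ℕ} {m : ℕ∞ω}
    (b : Metric.sphere (0 : EuclideanSpace ℝ (Fin (n + 1))) 1)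
    {x : EuclideanSpace ℝ (Fin (n + 1))} (hx : x ≠ 0) :
    ContMDiffAt 𝓘(ℝ, EuclideanSpace ℝ (Fin (n + 1))) (𝓡 n) m (sphereProj b) x := by
  have := Fact.mk (@finrank_euclideanSpace_fin ℝ _ (n + 1))
  apply contMDiffAt_sphere_of_coe
  have h : ContDiffAt ℝ m (fun y : EuclideanSpace ℝ (Fin (n + 1)) ↦ ‖y‖⁻¹ • y) x :=
    ((contDiffAt_norm ℝ hx).inv (norm_ne_zero_iff.2 hx)).smul contDiffAt_id
  refine (h.congr_of_eventuallyEq ?_).contMDiffAt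
  filter_upwards [isOpen_ne.mem_nhds hx] with y hy using coe_sphereProj b hy

lemma contDiff_octMul_octIm {m : ℕ∞ω} :
    ContDiff ℝ m fun p : EuclideanSpace ℝ (Fin 7) × EuclideanSpace ℝ (Fin 8) ↦
      octMul (octIm p.1) p.2 := by
  have hz (i : Fin 7) : ContDiff ℝ m
      fun p : EuclideanSpace ℝ (Fin 7) × EuclideanSpace ℝ (Fin 8) ↦ p.1 i :=
    (contDiff_euclidean.1 contDiff_id i).comp contDiff_fst
  have hy (i : Fin 8) : ContDiff ℝ m
      fun p : EuclideanSpace ℝ (Fin 7) × EuclideanSpace ℝ (Fin 8) ↦ p.2 i :=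
    (contDiff_euclidean.1 contDiff_id i).comp contDiff_snd
  simp only [octMul_octIm_apply]
  rw [contDiff_euclidean]
  intro i
  fin_cases i <;>
    apply_rules [ContDiff.add, ContDiff.sub, ContDiff.neg, ContDiff.mul, hz, hy]

lemma contDiff_R16_fst {m : ℕ∞ω} : ContDiff ℝ m fun x : R16 ↦ x.fst :=
  (WithLp.fstL 2 ℝ (EuclideanSpace ℝ (Fin 8)) (EuclideanSpace ℝ (Fin 8))).contDiff

lemma contDiff_R16_snd {m : ℕ∞ω} : ContDiff ℝ m fun x : R16 ↦ x.snd :=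
  (WithLp.sndL 2 ℝ (EuclideanSpace ℝ (Fin 8)) (EuclideanSpace ℝ (Fin 8))).contDiff

lemma contDiff_octQuot {m : ℕ∞ω} : ContDiff ℝ m fun x : R16 ↦ octQuot x.fst x.snd := by
  rw [contDiff_euclidean]
  intro i
  have h : ContDiff ℝ m fun x : R16 ↦ octMul (octIm (EuclideanSpace.single i 1)) x.fst :=
    ContDiff.comp (f := fun x : R16 ↦ (EuclideanSpace.single i (1 : ℝ), x.fst))
      contDiff_octMul_octIm (contDiff_const.prodMk contDiff_R16_fst)
  exact h.inner ℝ contDiff_R16_snd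

lemma contMDiffAt_psiInv {m : ℕ∞ω} {x : R16} (hx : x ≠ 0) (hn : ‖x.fst‖ = ‖x.snd‖)
    (ho : ⟪x.fst, x.snd⟫ = 0) : ContMDiffAt 𝓘(ℝ, R16) modelS7S6 m psiInv x := by
  have hu : ‖x.fst‖ ≠ 0 := by
    intro h
    have hx2 := WithLp.prod_norm_sq_eq_of_L2 x
    rw [← hn, h] at hx2
    exact hx (by simpa using hx2)
  have hu0 := norm_ne_zero_iff.1 hu
  have hq : octQuot x.fst x.snd ≠ 0 := by
    rw [← norm_ne_zero_iff, norm_octQuot ho hu0, ← hn]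
    exact mul_ne_zero hu hu
  refine ContMDiffAt.prodMk ?_ ?_
  · exact ContMDiffAt.comp (g := sphereProj (sphereBase 7)) (f := fun y : R16 ↦ y.fst) x
      (contMDiffAt_sphereProj _ hu0) contDiff_R16_fst.contMDiff.contMDiffAt
  · exact ContMDiffAt.comp (g := sphereProj (sphereBase 6))
      (f := fun y : R16 ↦ octQuot y.fst y.snd) x
      (contMDiffAt_sphereProj _ hq) contDiff_octQuot.contMDiff.contMDiffAt

lemma contMDiff_psiMap {m : ℕ∞ω} : ContMDiff modelS7S6 𝓘(ℝ, R16) m psiMap := by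
  have h1 : ContMDiff (𝓡 7) 𝓘(ℝ, EuclideanSpace ℝ (Fin 8)) m (fun y : S7 ↦ (y : EuclideanSpace ℝ (Fin 8))) := by
    have := Fact.mk (@finrank_euclideanSpace_fin ℝ _ (7 + 1))
    exact contMDiff_coe_sphere
  have h2 : ContMDiff (𝓡 6) 𝓘(ℝ, EuclideanSpace ℝ (Fin 7)) m (fun y : S6 ↦ (y : EuclideanSpace ℝ (Fin 7))) := by
    have := Fact.mk (@finrank_euclideanSpace_fin ℝ _ (6 + 1))
    exact contMDiff_coe_sphere
  have h3 : ContDiff ℝ m fun p : EuclideanSpace ℝ (Fin 8) × EuclideanSpace ℝ (Fin 7) ↦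
      (1 / Real.sqrt 2) • (WithLp.toLp 2 (p.1, octMul (octIm p.2) p.1) : R16) :=
    ((WithLp.prodContinuousLinearEquiv 2 ℝ _ _).symm.contDiff.comp
      (contDiff_fst.prodMk (contDiff_octMul_octIm.comp (contDiff_snd.prodMk contDiff_fst)))).const_smul _
  exact h3.contMDiff.comp ((h1.comp contMDiff_fst).prodMk_space (h2.comp contMDiff_snd))

lemma isClosedEmbedding_psiMap : Topology.IsClosedEmbedding psiMap :=
  (contMDiff_psiMap (m := 0)).continuous.isClosedEmbedding
    (Function.LeftInverse.injective psiInv_psiMap)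

/-! ### From injective differentials to immersions -/

section Immersion
open Module Topology
variable {E F E' : Type*} [NormedAddCommGroup E] [NormedSpace ℝ E] [FiniteDimensional ℝ E]
  [NormedAddCommGroup F] [NormedSpace ℝ F] [FiniteDimensional ℝ F]
  [NormedAddCommGroup E'] [NormedSpace ℝ E'] [FiniteDimensional ℝ E']

/-- An injective linear map extends to a linear equivalence from the product of its domain with any
space of complementary dimension. -/
lemma exists_continuousLinearEquiv_prod_of_injective (A : E →L[ℝ] E') (hA : Function.Injective A)
    (hdim : finrank ℝ E + finrank ℝ F = finrank ℝ E') :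
    ∃ (L : (E × F) ≃L[ℝ] E') (B : F →L[ℝ] E'), ∀ u c, L (u, c) = A u + B c := by
  obtain ⟨C, hC⟩ := Submodule.exists_isCompl (LinearMap.range (A : E →ₗ[ℝ] E'))
  have h1 := Submodule.finrank_add_eq_of_isCompl hC
  rw [LinearMap.finrank_range_of_inj hA] at h1
  let e : F ≃ₗ[ℝ] C := LinearEquiv.ofFinrankEq _ _ (by omega)
  refine ⟨(((LinearEquiv.ofInjective (A : E →ₗ[ℝ] E') hA).prodCongr e).trans
    (Submodule.prodEquivOfIsCompl _ _ hC)).toContinuousLinearEquiv,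
    LinearMap.toContinuousLinearMap (C.subtype ∘ₗ e.toLinearMap), fun u c ↦ ?_⟩
  simp

variable {H M : Type*} [TopologicalSpace H] {I : ModelWithCorners ℝ E H} [I.Boundaryless]
  [TopologicalSpace M] [ChartedSpace H M] {n : ℕ∞ω} [IsManifold I n M]

/-- A smooth map to a vector space with injective differential at `x` is an immersion at `x`. -/
lemma isImmersionAtOfComplement_of_injective_mfderiv {f : M → E'} (hf : ContMDiff I 𝓘(ℝ, E') n f)
    (hn : n ≠ 0) {x : M} (hinj : Function.Injective (mfderiv I 𝓘(ℝ, E') f x))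
    (hdim : finrank ℝ E + finrank ℝ F = finrank ℝ E') :
    Manifold.IsImmersionAtOfComplement F I 𝓘(ℝ, E') n f x := by
  have hn1 : (1 : ℕ∞ω) ≤ n := ENat.one_le_iff_ne_zero_withTop.2 hn
  let φ := extChartAt I x
  let f' : E → E' := f ∘ φ.symm
  have hφo : IsOpen φ.target := isOpen_extChartAt_target x
  have hf' : ContDiffOn ℝ n f' φ.target :=
    (hf.contMDiffOn (s := Set.univ)).comp (contMDiffOn_extChartAt_symm x)
      (fun _ _ ↦ Set.mem_univ _) |>.contDiffOn
  obtain ⟨A, hAx, hAinj⟩ : ∃ A : E →L[ℝ] E', HasFDerivAt f' A (φ x) ∧ Function.Injective A := by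
    let A : E →L[ℝ] E' := mfderiv I 𝓘(ℝ, E') f x
    have h : HasFDerivWithinAt f' A (Set.range I) (φ x) :=
      ((hf x).mdifferentiableAt hn).hasMFDerivAt.2
    rw [I.range_eq_univ, hasFDerivWithinAt_univ] at h
    exact ⟨A, h, hinj⟩
  obtain ⟨L, B, hL⟩ := exists_continuousLinearEquiv_prod_of_injective (F := F) A hAinj hdim
  -- Thickening `f'` in the complementary directions makes the derivative at `(φ x, 0)` the
  -- equivalence `L`, so the inverse function theorem applies.
  let G : E × F → E' := fun p ↦ f' p.1 + B p.2
  let U : Set (E × F) := φ.target ×ˢ Set.univ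
  have hU : IsOpen U := hφo.prod isOpen_univ
  have hG : ContDiffOn ℝ n G U :=
    (hf'.comp contDiff_fst.contDiffOn fun p hp ↦ hp.1).add
      (B.contDiff.comp contDiff_snd).contDiffOn
  have hp0 : ((φ x, 0) : E × F) ∈ U := ⟨mem_extChartAt_target x, Set.mem_univ _⟩
  have hG0 : ContDiffAt ℝ n G (φ x, 0) := hG.contDiffAt (hU.mem_nhds hp0)
  have hGL : HasFDerivAt G (L : E × F →L[ℝ] E') (φ x, 0) := by
    have h1 : HasFDerivAt G (A.comp (ContinuousLinearMap.fst ℝ E F) +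
        B.comp (ContinuousLinearMap.snd ℝ E F)) (φ x, 0) :=
      (HasFDerivAt.comp (g := f') (f := Prod.fst) ((φ x, 0) : E × F) hAx hasFDerivAt_fst).add
        (HasFDerivAt.comp (g := B) (f := Prod.snd) ((φ x, 0) : E × F) B.hasFDerivAt hasFDerivAt_snd)
    convert h1 using 1
    ext p <;> simp [hL]
  let Φ := hG0.toOpenPartialHomeomorph G hGL hn
  -- A codomain chart needs an inverse that is smooth on its whole domain, so `G` is restricted to
  -- where its derivative stays invertible, an open condition.
  let S : Set (E × F) := {p | fderiv ℝ G p ∈ Set.range ((↑) : ((E × F) ≃L[ℝ] E') → _)} ∩ U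
  have hS : S ∈ 𝓝 ((φ x, 0) : E × F) := by
    refine Filter.inter_mem ?_ (hU.mem_nhds hp0)
    have hc : ContinuousAt (fderiv ℝ G) (φ x, 0) :=
      (hG0.fderiv_right (m := 0) (by simpa using hn1)).continuousAt
    refine hc.preimage_mem_nhds (ContinuousLinearEquiv.isOpen.mem_nhds ⟨L, hGL.fderiv.symm⟩)
  let Ψ := Φ.restr S
  have hΨS : ∀ p ∈ Ψ.source, p ∈ S := fun p hp ↦ by
    rw [Φ.restr_source] at hp
    exact interior_subset hp.2
  have hx0 : ((φ x, 0) : E × F) ∈ Ψ.source := by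
    rw [Φ.restr_source]
    exact ⟨hG0.mem_toOpenPartialHomeomorph_source hGL hn, mem_interior_iff_mem_nhds.2 hS⟩
  have hΨ1 : ContDiffOn ℝ n Ψ Ψ.source := hG.mono fun p hp ↦ (hΨS p hp).2
  have hΨ2 : ContDiffOn ℝ n Ψ.symm Ψ.target := by
    intro q hq
    have hs := Ψ.map_target hq
    obtain ⟨⟨L', hL'⟩, hqU⟩ := hΨS _ hs
    have hGq : ContDiffAt ℝ n G (Ψ.symm q) := hG.contDiffAt (hU.mem_nhds hqU)
    refine (Ψ.contDiffAt_symm (f₀' := L') hq ?_ hGq).contDiffWithinAt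
    rw [hL']
    exact (hGq.differentiableAt hn).hasFDerivAt
  -- `Ψ.symm` flattens the image of `f` into `E × {0}`; `L` moves the result back to `E'`, where the
  -- charts take values.
  let cod : OpenPartialHomeomorph E' E' := Ψ.symm.trans L.toHomeomorph.toOpenPartialHomeomorph
  have hcod : cod ∈ IsManifold.maximalAtlas 𝓘(ℝ, E') n E' := by
    apply OpenPartialHomeomorph.mem_maximalAtlas_of_contMDiffOn
    · rw [contMDiffOn_iff_contDiffOn]
      have : cod.source = Ψ.target := by simp [cod]
      rw [this]
      exact L.contDiff.comp_contDiffOn hΨ2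
    · rw [contMDiffOn_iff_contDiffOn]
      have : cod.target = L.symm ⁻¹' Ψ.source := by ext; simp [cod]
      rw [this]
      exact hΨ1.comp L.symm.contDiff.contDiffOn fun _ h ↦ h
  have hcont : ContinuousOn (fun y ↦ ((φ y, 0) : E × F)) (chartAt H x).source := by
    refine ContinuousOn.prodMk ?_ continuousOn_const
    have := continuousOn_extChartAt (I := I) x
    rwa [extChartAt_source] at this
  let T : Set M := (chartAt H x).source ∩ (fun y ↦ ((φ y, 0) : E × F)) ⁻¹' Ψ.source
  have hT : IsOpen T := hcont.isOpen_inter_preimage (chartAt H x).open_source Ψ.open_source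
  have hxT : x ∈ T := ⟨mem_chart_source H x, hx0⟩
  let dom := (chartAt H x).restr T
  have hdom_source : dom.source = T := by
    rw [(chartAt H x).restr_source, hT.interior_eq]
    exact Set.inter_eq_right.2 Set.inter_subset_left
  have hval : ∀ y ∈ T, G (φ y, 0) = f y := fun y hy ↦ by
    have : φ.symm (φ y) = y := φ.left_inv (by rw [extChartAt_source]; exact hy.1)
    simp [G, f', this]
  refine Manifold.IsImmersionAtOfComplement.mk_of_charts L dom cod (hdom_source ▸ hxT) ?_
    (restr_mem_maximalAtlas _ (IsManifold.chart_mem_maximalAtlas x) hT) hcod ?_ ?_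
  · have : cod.source = Ψ.target := by simp [cod]
    rw [this, ← hval x hxT]
    exact Ψ.map_source hx0
  · intro y hy
    rw [hdom_source] at hy
    have : cod.source = Ψ.target := by simp [cod]
    rw [Set.mem_preimage, this, ← hval y hy]
    exact Ψ.map_source hy.2
  · intro u hu
    set y := (dom.extend I).symm u with hy_def
    have hy : y ∈ T := by
      have := (dom.extend I).map_target hu
      rwa [OpenPartialHomeomorph.extend_source, hdom_source] at this
    have hu' : φ y = u := (dom.extend I).right_inv hu
    have h1 : Ψ.symm (f y) = (u, 0) := by
      rw [← hval y hy, ← hu']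
      exact Ψ.left_inv hy.2
    change L (Ψ.symm (f y)) = L (u, 0)
    rw [h1]

end Immersion

/-- By the chain rule, the differential of `psiInv` is a left inverse. -/
lemma injective_mfderiv_psiMap (p : S7 × S6) :
    Function.Injective (mfderiv modelS7S6 𝓘(ℝ, R16) psiMap p) := by
  have h1 : MDifferentiableAt modelS7S6 𝓘(ℝ, R16) psiMap p :=
    (contMDiff_psiMap (m := 1) p).mdifferentiableAt one_ne_zero
  have h2 : MDifferentiableAt 𝓘(ℝ, R16) modelS7S6 psiInv (psiMap p) := by
    refine (contMDiffAt_psiInv (m := 1) ?_ ?_ ?_).mdifferentiableAt one_ne_zero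
    · rw [← norm_ne_zero_iff, norm_psiMap]
      exact one_ne_zero
    · rw [norm_psiMap_fst, norm_psiMap_snd]
    · exact inner_psiMap_fst_snd p
  have h3 := mfderiv_comp p h2 h1
  have h4 : psiInv ∘ psiMap = id := funext psiInv_psiMap
  rw [h4, mfderiv_id] at h3
  exact Function.LeftInverse.injective (g := mfderiv 𝓘(ℝ, R16) modelS7S6 psiInv (psiMap p))
    fun v ↦ (DFunLike.congr_fun h3 v).symm

lemma isSmoothEmbedding_psiMap : Manifold.IsSmoothEmbedding modelS7S6 𝓘(ℝ, R16) ∞ psiMap where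
  isEmbedding := isClosedEmbedding_psiMap.isEmbedding
  -- The complement has dimension 3, because `(7 + 6) + 3 = 16`.
  isImmersion := ⟨EuclideanSpace ℝ (Fin 3), inferInstance, inferInstance, fun p ↦
    isImmersionAtOfComplement_of_injective_mfderiv contMDiff_psiMap (by simp)
      (injective_mfderiv_psiMap p)
      (by simp [(WithLp.linearEquiv 2 ℝ
        (EuclideanSpace ℝ (Fin 8) × EuclideanSpace ℝ (Fin 8))).finrank_eq])⟩

/-! ### Complex coordinates on `ℝ¹⁶` -/

/-- The identification of `ℝ⁸ ⊕ ℝ⁸` with `ℂ⁸` by `(u, v) ↦ u - i v`, which turns `P₀ P₁` into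
multiplication by `i`. -/
def toCplxLinear : R16 ≃ₗ[ℝ] EuclideanSpace ℂ (Fin 8) where
  toFun x := WithLp.toLp 2 fun j ↦ ⟨x.fst j, -x.snd j⟩
  invFun w := WithLp.toLp 2 (WithLp.toLp 2 fun j ↦ (w j).re, WithLp.toLp 2 fun j ↦ -(w j).im)
  map_add' x y := by
    ext j
    apply Complex.ext <;> simp [add_comm]
  map_smul' c x := by
    ext j
    apply Complex.ext <;> simp
  left_inv x := by
    apply WithLp.ofLp_injective 2
    apply Prod.ext <;> ext j <;> simp
  right_inv w := by
    ext j
    apply Complex.ext <;> simp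

/-- `toCplxLinear` as a continuous linear equivalence. -/
def toCplx : R16 ≃L[ℝ] EuclideanSpace ℂ (Fin 8) where
  toLinearEquiv := toCplxLinear
  continuous_toFun := by
    refine (PiLp.continuous_toLp _ _).comp (continuous_pi fun j ↦ ?_)
    exact Complex.equivRealProdCLM.symm.continuous.comp
      ((contDiff_euclidean.1 (contDiff_R16_fst (m := 0)) j).continuous.prodMk
        (contDiff_euclidean.1 (contDiff_R16_snd (m := 0)) j).continuous.neg)
  continuous_invFun := by
    have h (j : Fin 8) : Continuous fun w : EuclideanSpace ℂ (Fin 8) ↦ w j := by fun_prop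
    refine (WithLp.prod_continuous_toLp 2 _ _).comp (Continuous.prodMk ?_ ?_)
    · exact (PiLp.continuous_toLp _ _).comp
        (continuous_pi fun j ↦ Complex.continuous_re.comp (h j))
    · exact (PiLp.continuous_toLp _ _).comp
        (continuous_pi fun j ↦ (Complex.continuous_im.comp (h j)).neg)

lemma toCplx_apply (x : R16) (j : Fin 8) : toCplx x j = ⟨x.fst j, -x.snd j⟩ := rfl

lemma toCplx_etaField (x : R16) : toCplx (etaField x) = Complex.I • toCplx x := by
  ext j
  apply Complex.ext <;> simp [toCplx_apply, etaField, cliffP0, cliffP1]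

lemma toCplx_symm_I_smul (w : EuclideanSpace ℂ (Fin 8)) :
    toCplx.symm (Complex.I • w) = etaField (toCplx.symm w) := by
  rw [ContinuousLinearEquiv.symm_apply_eq, toCplx_etaField, ContinuousLinearEquiv.apply_symm_apply]

/-- The sum has real part `|u|² - |v|²` and imaginary part `-2⟪u, v⟫`. -/
lemma sum_toCplx_sq_eq_zero_iff (x : R16) :
    ∑ j, toCplx x j ^ 2 = 0 ↔ ‖x.fst‖ = ‖x.snd‖ ∧ ⟪x.fst, x.snd⟫ = 0 := by
  have h : ∑ j, toCplx x j ^ 2 = ⟨‖x.fst‖ ^ 2 - ‖x.snd‖ ^ 2, -2 * ⟪x.fst, x.snd⟫⟩ := by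
    apply Complex.ext
    · rw [Complex.re_sum, EuclideanSpace.real_norm_sq_eq, EuclideanSpace.real_norm_sq_eq,
        ← Finset.sum_sub_distrib]
      dsimp only
      refine Finset.sum_congr rfl fun j _ ↦ ?_
      simp only [toCplx_apply, pow_two, Complex.mul_re]
      ring
    · rw [Complex.im_sum, PiLp.inner_apply, Finset.mul_sum]
      dsimp only
      refine Finset.sum_congr rfl fun j _ ↦ ?_
      simp only [toCplx_apply, pow_two, Complex.mul_im, RCLike.inner_apply,
        conj_trivial]
      ring
  rw [h, Complex.ext_iff, ← sq_eq_sq₀ (norm_nonneg x.fst) (norm_nonneg x.snd)]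
  simp [sub_eq_zero]

/-! ### Coordinates on the complex cone `∑ wⱼ² = 0` -/

/-- The linear projection `w ↦ (w₀ + i w₁, w₂, …, w₇)`, after a permutation of the coordinates. -/
def coneCoord (σ : Equiv.Perm (Fin 8)) :
    EuclideanSpace ℂ (Fin 8) →L[ℂ] EuclideanSpace ℂ (Fin 7) :=
  LinearMap.toContinuousLinearMap
    { toFun := fun w ↦ WithLp.toLp 2
        (Fin.cons (w (σ 0) + Complex.I * w (σ 1)) fun l : Fin 6 ↦ w (σ l.succ.succ))
      map_add' := fun w w' ↦ by
        ext l
        refine Fin.cases ?_ (fun l ↦ ?_) l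
        · simp; ring
        · simp
      map_smul' := fun c w ↦ by
        ext l
        refine Fin.cases ?_ (fun l ↦ ?_) l
        · simp; ring
        · simp }

lemma coneCoord_zero (σ : Equiv.Perm (Fin 8)) (w : EuclideanSpace ℂ (Fin 8)) :
    coneCoord σ w 0 = w (σ 0) + Complex.I * w (σ 1) := rfl

lemma coneCoord_succ (σ : Equiv.Perm (Fin 8)) (w : EuclideanSpace ℂ (Fin 8)) (l : Fin 6) :
    coneCoord σ w l.succ = w (σ l.succ.succ) := rfl

/-- The value of `w₀ - i w₁` at the point of the cone with given coordinates. -/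
def coneRest (c : EuclideanSpace ℂ (Fin 7)) : ℂ := -(∑ l : Fin 6, c l.succ ^ 2) / c 0

/-- The point of the cone with given coordinates. -/
def conePoint (σ : Equiv.Perm (Fin 8)) (c : EuclideanSpace ℂ (Fin 7)) : EuclideanSpace ℂ (Fin 8) :=
  WithLp.toLp 2 fun j ↦ (Fin.cons ((c 0 + coneRest c) / 2)
    (Fin.cons (Complex.I * (coneRest c - c 0) / 2) fun l : Fin 6 ↦ c l.succ) : Fin 8 → ℂ) (σ.symm j)

lemma conePoint_zero (σ : Equiv.Perm (Fin 8)) (c : EuclideanSpace ℂ (Fin 7)) :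
    conePoint σ c (σ 0) = (c 0 + coneRest c) / 2 := by
  simp [conePoint]

lemma conePoint_one (σ : Equiv.Perm (Fin 8)) (c : EuclideanSpace ℂ (Fin 7)) :
    conePoint σ c (σ 1) = Complex.I * (coneRest c - c 0) / 2 := by
  simp only [conePoint, Equiv.symm_apply_apply]
  rfl

lemma conePoint_succ_succ (σ : Equiv.Perm (Fin 8)) (c : EuclideanSpace ℂ (Fin 7)) (l : Fin 6) :
    conePoint σ c (σ l.succ.succ) = c l.succ := by
  simp [conePoint]

lemma coneCoord_conePoint (σ : Equiv.Perm (Fin 8)) (c : EuclideanSpace ℂ (Fin 7)) :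
    coneCoord σ (conePoint σ c) = c := by
  ext l
  refine Fin.cases ?_ (fun l ↦ ?_) l
  · rw [coneCoord_zero, conePoint_zero, conePoint_one]
    linear_combination (coneRest c - c 0) / 2 * Complex.I_mul_I
  · rw [coneCoord_succ, conePoint_succ_succ]

lemma sum_perm_eight (σ : Equiv.Perm (Fin 8)) (f : Fin 8 → ℂ) :
    ∑ j, f j = f (σ 0) + f (σ 1) + ∑ l : Fin 6, f (σ l.succ.succ) := by
  rw [← Equiv.sum_comp σ, Fin.sum_univ_succ, Fin.sum_univ_succ, ← add_assoc]
  rfl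

lemma sum_conePoint_sq (σ : Equiv.Perm (Fin 8)) {c : EuclideanSpace ℂ (Fin 7)} (hc : c 0 ≠ 0) :
    ∑ j, conePoint σ c j ^ 2 = 0 := by
  rw [sum_perm_eight σ, conePoint_zero, conePoint_one]
  simp only [conePoint_succ_succ]
  have h : coneRest c * c 0 = -(∑ l : Fin 6, c l.succ ^ 2) := div_mul_cancel₀ _ hc
  linear_combination (coneRest c - c 0) ^ 2 / 4 * Complex.I_mul_I + h

/-- Up to the permutation, the cone equation is `(w₀ + i w₁)(w₀ - i w₁) = -∑ wₗ²`, with `l` from 2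
to 7. Where `w₀ + i w₁ ≠ 0` it determines `w₀ - i w₁`, so the cone is a graph over the other seven
coordinates. -/
lemma conePoint_coneCoord (σ : Equiv.Perm (Fin 8)) {w : EuclideanSpace ℂ (Fin 8)}
    (hw : ∑ j, w j ^ 2 = 0) (h0 : coneCoord σ w 0 ≠ 0) : conePoint σ (coneCoord σ w) = w := by
  have hr : coneRest (coneCoord σ w) = w (σ 0) - Complex.I * w (σ 1) := by
    rw [coneRest, div_eq_iff h0, coneCoord_zero]
    simp only [coneCoord_succ]
    rw [sum_perm_eight σ] at hw
    linear_combination -hw + w (σ 1) ^ 2 * Complex.I_mul_I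
  ext j
  obtain ⟨i, rfl⟩ := σ.surjective j
  refine Fin.cases ?_ (fun i ↦ Fin.cases ?_ (fun l ↦ ?_) i) i
  · rw [conePoint_zero, hr, coneCoord_zero]
    ring
  · change conePoint σ (coneCoord σ w) (σ 1) = w (σ 1)
    rw [conePoint_one, hr, coneCoord_zero]
    linear_combination -w (σ 1) * Complex.I_mul_I
  · rw [conePoint_succ_succ, coneCoord_succ]

/-- If every `w_a + i w_b` with `a ≠ b` vanished, then combining the pairs `(j, k)` and `(k, j)`
would give `2 w_j = 0`. This is why the coordinates are permuted: the charts then cover the cone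
minus its vertex. -/
lemma exists_coneCoord_ne_zero {w : EuclideanSpace ℂ (Fin 8)} (hw : w ≠ 0) :
    ∃ σ, coneCoord σ w 0 ≠ 0 := by
  by_contra! h
  apply hw
  ext j
  obtain ⟨k, hk⟩ : ∃ k : Fin 8, k ≠ j := exists_ne j
  have key : ∀ a b : Fin 8, a ≠ b → w a + Complex.I * w b = 0 := by
    intro a b hab
    obtain ⟨σ, h0, h1⟩ : ∃ σ : Equiv.Perm (Fin 8), σ 0 = a ∧ σ 1 = b := by
      let τ := Equiv.swap (0 : Fin 8) a
      have hb : τ.symm b ≠ 0 := by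
        intro hb0
        rw [Equiv.symm_apply_eq] at hb0
        exact hab (by simpa [τ] using hb0.symm)
      refine ⟨(Equiv.swap 1 (τ.symm b)).trans τ, ?_, ?_⟩
      · rw [Equiv.trans_apply, Equiv.swap_apply_of_ne_of_ne (by decide) hb.symm]
        simp [τ]
      · simp
    rw [← h0, ← h1, ← coneCoord_zero]
    exact h σ
  have h1 := key j k hk.symm
  have h2 := key k j hk
  have : 2 * w j = 0 := by
    linear_combination h1 - Complex.I * h2 + w j * Complex.I_mul_I
  simpa using this

lemma conePoint_ne_zero (σ : Equiv.Perm (Fin 8)) {c : EuclideanSpace ℂ (Fin 7)} (hc : c 0 ≠ 0) :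
    conePoint σ c ≠ 0 := by
  intro h
  have := coneCoord_conePoint σ c
  rw [h, map_zero] at this
  exact hc (by rw [← this]; rfl)

lemma isOpen_coord_zero_ne : IsOpen {c : EuclideanSpace ℂ (Fin 7) | c 0 ≠ 0} :=
  isOpen_ne_fun (by fun_prop) continuous_const

lemma contDiffAt_conePoint (σ : Equiv.Perm (Fin 8)) {n : ℕ∞ω} {c : EuclideanSpace ℂ (Fin 7)}
    (hc : c 0 ≠ 0) : ContDiffAt ℂ n (conePoint σ) c := by
  have hp (i : Fin 7) : ContDiffAt ℂ n (fun c : EuclideanSpace ℂ (Fin 7) ↦ c i) c :=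
    (contDiff_euclidean.1 contDiff_id i).contDiffAt
  have hr : ContDiffAt ℂ n coneRest c :=
    (ContDiffAt.sum fun l _ ↦ (hp l.succ).pow 2).neg.div (hp 0) hc
  rw [contDiffAt_euclidean]
  intro j
  obtain ⟨i, rfl⟩ := σ.surjective j
  refine Fin.cases ?_ (fun i ↦ Fin.cases ?_ (fun l ↦ ?_) i) i
  · simp only [conePoint_zero]
    exact ((hp 0).add hr).div_const 2
  · change ContDiffAt ℂ n (fun c ↦ conePoint σ c (σ 1)) c
    simp only [conePoint_one]
    exact (contDiffAt_const.mul (hr.sub (hp 0))).div_const 2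
  · simp only [conePoint_succ_succ]
    exact hp _

/-! ### Branches of the logarithm on the circle -/

/-- The branch of the argument on the circle with values in `(θ - π, θ + π]`. -/
def argBranch (θ : ℝ) (a : Circle) : ℝ := θ + Complex.arg (a * (Circle.exp θ)⁻¹ : Circle)

lemma exp_argBranch (θ : ℝ) (a : Circle) : Circle.exp (argBranch θ a) = a := by
  rw [argBranch, Circle.exp_add, Circle.exp_arg, mul_comm, inv_mul_cancel_right]

lemma argBranch_exp {θ s : ℝ} (h : |s - θ| < Real.pi) : argBranch θ (Circle.exp s) = s := by
  rw [abs_lt] at h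
  rw [argBranch, ← Circle.exp_neg, ← Circle.exp_add, Circle.arg_exp] <;> linarith

lemma abs_argBranch_sub_lt {θ : ℝ} {a : Circle}
    (h : ((a * (Circle.exp θ)⁻¹ : Circle) : ℂ) ∈ Complex.slitPlane) :
    |argBranch θ a - θ| < Real.pi := by
  rw [argBranch, add_sub_cancel_left, abs_lt]
  exact ⟨Complex.neg_pi_lt_arg _, lt_of_le_of_ne (Complex.arg_le_pi _)
    (Complex.mem_slitPlane_iff_arg.1 h).1⟩

lemma exp_mul_inv_mem_slitPlane {θ s : ℝ} (h : |s - θ| < Real.pi) :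
    ((Circle.exp s * (Circle.exp θ)⁻¹ : Circle) : ℂ) ∈ Complex.slitPlane := by
  rw [Complex.mem_slitPlane_iff_arg, ← Circle.exp_neg, ← Circle.exp_add]
  rw [abs_lt] at h
  refine ⟨?_, Circle.coe_ne_zero _⟩
  rw [Circle.arg_exp (by linarith) (by linarith)]
  linarith

lemma contMDiff_coe_circle {m : ℕ∞ω} : ContMDiff (𝓡 1) 𝓘(ℝ, ℂ) m (fun a : Circle ↦ (a : ℂ)) := by
  have : Fact (Module.finrank ℝ ℂ = 1 + 1) := ⟨Complex.finrank_real_complex⟩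
  exact contMDiff_coe_sphere

lemma contMDiffAt_argBranch {m : ℕ∞ω} {θ : ℝ} {a : Circle}
    (h : ((a * (Circle.exp θ)⁻¹ : Circle) : ℂ) ∈ Complex.slitPlane) :
    ContMDiffAt (𝓡 1) 𝓘(ℝ, ℝ) m (argBranch θ) a := by
  have h1 : ContDiffAt ℝ m (fun z : ℂ ↦ θ + (Complex.log (z * ((Circle.exp θ)⁻¹ : Circle))).im) a := by
    have h2 : ContDiffAt ℝ m (fun z : ℂ ↦ Complex.log (z * ((Circle.exp θ)⁻¹ : Circle))) a := by
      refine ContDiffAt.comp (g := Complex.log) (f := fun z : ℂ ↦ z * ((Circle.exp θ)⁻¹ : Circle))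
        (a : ℂ) ?_ (by fun_prop)
      exact (Complex.contDiffAt_log (by simpa using h)).restrict_scalars ℝ
    exact contDiffAt_const.add (Complex.imCLM.contDiff.contDiffAt.comp _ h2)
  have h3 : argBranch θ = (fun z : ℂ ↦ θ + (Complex.log (z * ((Circle.exp θ)⁻¹ : Circle))).im) ∘
      (fun a : Circle ↦ (a : ℂ)) := by
    ext b
    simp only [argBranch, Function.comp_apply, Complex.log_im, Circle.coe_mul]
  rw [h3]
  exact ContMDiffAt.comp
    (g := fun z : ℂ ↦ θ + (Complex.log (z * ((Circle.exp θ)⁻¹ : Circle))).im)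
    (f := fun a : Circle ↦ (a : ℂ)) a h1.contMDiffAt contMDiff_coe_circle.contMDiffAt

/-! ### Holomorphic charts on `S¹ × S⁷ × S⁶` -/

/-- `conePoint` as a point of `ℝ¹⁶`. -/
def coneReal (σ : Equiv.Perm (Fin 8)) (c : EuclideanSpace ℂ (Fin 7)) : R16 :=
  toCplx.symm (conePoint σ c)

lemma toCplx_coneReal (σ : Equiv.Perm (Fin 8)) (c : EuclideanSpace ℂ (Fin 7)) :
    toCplx (coneReal σ c) = conePoint σ c := toCplx.apply_symm_apply _

lemma coneReal_ne_zero (σ : Equiv.Perm (Fin 8)) {c : EuclideanSpace ℂ (Fin 7)} (hc : c 0 ≠ 0) :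
    coneReal σ c ≠ 0 := by
  intro h
  have := toCplx_coneReal σ c
  rw [h, map_zero] at this
  exact conePoint_ne_zero σ hc this.symm

lemma coneReal_orthogonal (σ : Equiv.Perm (Fin 8)) {c : EuclideanSpace ℂ (Fin 7)} (hc : c 0 ≠ 0) :
    ‖(coneReal σ c).fst‖ = ‖(coneReal σ c).snd‖ ∧ ⟪(coneReal σ c).fst, (coneReal σ c).snd⟫ = 0 := by
  rw [← sum_toCplx_sq_eq_zero_iff, toCplx_coneReal]
  exact sum_conePoint_sq σ hc

lemma contDiffAt_coneReal (σ : Equiv.Perm (Fin 8)) {n : ℕ∞ω} {c : EuclideanSpace ℂ (Fin 7)}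
    (hc : c 0 ≠ 0) : ContDiffAt ℝ n (coneReal σ) c :=
  toCplx.symm.contDiff.contDiffAt.comp c ((contDiffAt_conePoint σ hc).restrict_scalars ℝ)

/-- The point of `S¹ × S⁷ × S⁶` over the point of the cone with coordinates `c`. -/
def coneInv (σ : Equiv.Perm (Fin 8)) (c : EuclideanSpace ℂ (Fin 7)) : N14 :=
  (Circle.exp (Real.log ‖coneReal σ c‖), psiInv (coneReal σ c))

lemma psiMap_coneInv (σ : Equiv.Perm (Fin 8)) {c : EuclideanSpace ℂ (Fin 7)} (hc : c 0 ≠ 0) :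
    psiMap (coneInv σ c).2 = ‖coneReal σ c‖⁻¹ • coneReal σ c :=
  psiMap_psiInv (coneReal_ne_zero σ hc) (coneReal_orthogonal σ hc).1 (coneReal_orthogonal σ hc).2

lemma contMDiffAt_coneInv (σ : Equiv.Perm (Fin 8)) {n : ℕ∞ω} {c : EuclideanSpace ℂ (Fin 7)}
    (hc : c 0 ≠ 0) :
    ContMDiffAt 𝓘(ℝ, EuclideanSpace ℂ (Fin 7)) modelN14 n (coneInv σ) c := by
  have h0 := coneReal_ne_zero σ hc
  have h1 := contDiffAt_coneReal σ (n := n) hc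
  refine ContMDiffAt.prodMk ?_ ?_
  · have h2 : ContDiffAt ℝ n (fun c ↦ Real.log ‖coneReal σ c‖) c :=
      (h1.norm ℝ h0).log (norm_ne_zero_iff.2 h0)
    exact ContMDiffAt.comp (g := Circle.exp) (f := fun c ↦ Real.log ‖coneReal σ c‖) c
      contMDiff_circleExp.contMDiffAt h2.contMDiffAt
  · exact ContMDiffAt.comp (g := psiInv) (f := coneReal σ) c
      (contMDiffAt_psiInv h0 (coneReal_orthogonal σ hc).1 (coneReal_orthogonal σ hc).2)
      h1.contMDiffAt

/-- The point `eᵗ ψ(y, z)` of the cone, where `t` is the argument of `a` near `θ`, in the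
coordinates given by `σ`. -/
def coneMap (θ : ℝ) (σ : Equiv.Perm (Fin 8)) (p : N14) : EuclideanSpace ℂ (Fin 7) :=
  coneCoord σ (toCplx (Real.exp (argBranch θ p.1) • psiMap p.2))

/-- `coneCoord` on `ℝ¹⁶`, as a real linear map. -/
def coneCoordReal (σ : Equiv.Perm (Fin 8)) : R16 →L[ℝ] EuclideanSpace ℂ (Fin 7) :=
  ((coneCoord σ).restrictScalars ℝ).comp (toCplx : R16 →L[ℝ] EuclideanSpace ℂ (Fin 8))

lemma coneMap_eq (θ : ℝ) (σ : Equiv.Perm (Fin 8)) (p : N14) :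
    coneMap θ σ p = Real.exp (argBranch θ p.1) • coneCoordReal σ (psiMap p.2) :=
  map_smul (coneCoordReal σ) _ _

lemma contMDiffAt_coneMap {θ : ℝ} (σ : Equiv.Perm (Fin 8)) {n : ℕ∞ω} {p : N14}
    (hp : ((p.1 * (Circle.exp θ)⁻¹ : Circle) : ℂ) ∈ Complex.slitPlane) :
    ContMDiffAt modelN14 𝓘(ℝ, EuclideanSpace ℂ (Fin 7)) n (coneMap θ σ) p := by
  have h1 : ContMDiffAt modelN14 𝓘(ℝ, ℝ) n (fun p : N14 ↦ argBranch θ p.1) p :=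
    ContMDiffAt.comp (g := argBranch θ) (f := fun p : N14 ↦ p.1) p
      (contMDiffAt_argBranch hp) contMDiffAt_fst
  have h2 : ContMDiffAt modelN14 𝓘(ℝ, R16) n (fun p : N14 ↦ psiMap p.2) p :=
    ContMDiffAt.comp (g := psiMap) (f := fun p : N14 ↦ p.2) p
      contMDiff_psiMap.contMDiffAt contMDiffAt_snd
  have h3 : ContDiff ℝ n fun q : ℝ × R16 ↦ Real.exp q.1 • coneCoordReal σ q.2 :=
    (Real.contDiff_exp.comp contDiff_fst).smul ((coneCoordReal σ).contDiff.comp contDiff_snd)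
  have h4 : coneMap θ σ = (fun q : ℝ × R16 ↦ Real.exp q.1 • coneCoordReal σ q.2) ∘
      fun p ↦ (argBranch θ p.1, psiMap p.2) := funext (coneMap_eq θ σ)
  rw [h4]
  exact ContMDiffAt.comp (f := fun p : N14 ↦ (argBranch θ p.1, psiMap p.2)) p
    h3.contMDiff.contMDiffAt (h1.prodMk_space h2)

lemma coneReal_coneMap {θ : ℝ} {σ : Equiv.Perm (Fin 8)} {p : N14} (hp : coneMap θ σ p 0 ≠ 0) :
    coneReal σ (coneMap θ σ p) = Real.exp (argBranch θ p.1) • psiMap p.2 := by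
  rw [coneReal, coneMap, conePoint_coneCoord, toCplx.symm_apply_apply]
  · rw [sum_toCplx_sq_eq_zero_iff, WithLp.smul_fst, WithLp.smul_snd, norm_smul, norm_smul,
      norm_psiMap_fst, norm_psiMap_snd, inner_smul_left, inner_smul_right, inner_psiMap_fst_snd]
    simp
  · exact hp

lemma norm_coneReal_coneMap {θ : ℝ} {σ : Equiv.Perm (Fin 8)} {p : N14} (hp : coneMap θ σ p 0 ≠ 0) :
    ‖coneReal σ (coneMap θ σ p)‖ = Real.exp (argBranch θ p.1) := by
  rw [coneReal_coneMap hp, norm_smul, norm_psiMap, mul_one, Real.norm_of_nonneg (Real.exp_pos _).le]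

lemma coneInv_coneMap {θ : ℝ} {σ : Equiv.Perm (Fin 8)} {p : N14} (hp : coneMap θ σ p 0 ≠ 0) :
    coneInv σ (coneMap θ σ p) = p := by
  refine Prod.ext ?_ ?_
  · change Circle.exp (Real.log ‖coneReal σ (coneMap θ σ p)‖) = p.1
    rw [norm_coneReal_coneMap hp, Real.log_exp, exp_argBranch]
  · change psiInv (coneReal σ (coneMap θ σ p)) = p.2
    rw [coneReal_coneMap hp, psiInv_smul_psiMap (Real.exp_pos _)]

/-- The coordinate change from `σ` to `σ'`, up to the branch of the argument. -/
lemma coneMap_coneInv (θ : ℝ) (σ σ' : Equiv.Perm (Fin 8)) {c : EuclideanSpace ℂ (Fin 7)}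
    (hc : c 0 ≠ 0) :
    coneMap θ σ' (coneInv σ c) =
      Real.exp (argBranch θ (Circle.exp (Real.log ‖coneReal σ c‖)) - Real.log ‖coneReal σ c‖) •
        coneCoord σ' (conePoint σ c) := by
  have h0 : 0 < ‖coneReal σ c‖ := norm_pos_iff.2 (coneReal_ne_zero σ hc)
  rw [coneMap_eq, psiMap_coneInv σ hc, map_smul, smul_smul, Real.exp_sub, Real.exp_log h0,
    ← div_eq_mul_inv]
  congr 1
  change coneCoord σ' (toCplx (coneReal σ c)) = _
  rw [toCplx_coneReal]

/-- The domain of the chart `coneChart θ σ`. -/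
def coneSource (θ : ℝ) (σ : Equiv.Perm (Fin 8)) : Set N14 :=
  {p | ((p.1 * (Circle.exp θ)⁻¹ : Circle) : ℂ) ∈ Complex.slitPlane ∧
    coneCoordReal σ (psiMap p.2) 0 ≠ 0}

/-- The range of the chart `coneChart θ σ`. -/
def coneTarget (θ : ℝ) (σ : Equiv.Perm (Fin 8)) : Set (EuclideanSpace ℂ (Fin 7)) :=
  {c | c 0 ≠ 0} ∩ (fun c ↦ Real.log ‖coneReal σ c‖) ⁻¹' {s | |s - θ| < Real.pi}

lemma coneMap_zero_ne {θ : ℝ} {σ : Equiv.Perm (Fin 8)} {p : N14} (hp : p ∈ coneSource θ σ) :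
    coneMap θ σ p 0 ≠ 0 := by
  rw [coneMap_eq, PiLp.smul_apply]
  exact smul_ne_zero (Real.exp_pos _).ne' hp.2

lemma isOpen_coneSource (θ : ℝ) (σ : Equiv.Perm (Fin 8)) : IsOpen (coneSource θ σ) := by
  have h1 : Continuous fun p : N14 ↦ ((p.1 * (Circle.exp θ)⁻¹ : Circle) : ℂ) :=
    continuous_subtype_val.comp (continuous_fst.mul continuous_const)
  have h2 : Continuous fun p : N14 ↦ coneCoordReal σ (psiMap p.2) 0 := by
    have h3 : Continuous fun c : EuclideanSpace ℂ (Fin 7) ↦ c 0 := by fun_prop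
    exact h3.comp ((coneCoordReal σ).continuous.comp
      ((contMDiff_psiMap (m := 0)).continuous.comp continuous_snd))
  exact (Complex.isOpen_slitPlane.preimage h1).inter (isOpen_ne_fun h2 continuous_const)

lemma continuousOn_log_norm_coneReal (σ : Equiv.Perm (Fin 8)) :
    ContinuousOn (fun c ↦ Real.log ‖coneReal σ c‖) {c : EuclideanSpace ℂ (Fin 7) | c 0 ≠ 0} :=
  fun _ hc ↦ ((contDiffAt_coneReal σ (n := 0) hc).continuousAt.norm.log
    (norm_ne_zero_iff.2 (coneReal_ne_zero σ hc))).continuousWithinAt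

lemma isOpen_coneTarget (θ : ℝ) (σ : Equiv.Perm (Fin 8)) : IsOpen (coneTarget θ σ) :=
  (continuousOn_log_norm_coneReal σ).isOpen_inter_preimage isOpen_coord_zero_ne
    (isOpen_lt (by fun_prop) continuous_const)

/-- The holomorphic charts of `S¹ × S⁷ × S⁶`: the universal cover `ℝ × M₊` is identified with the
cone by `(t, x) ↦ eᵗ x`. -/
def coneChart (θ : ℝ) (σ : Equiv.Perm (Fin 8)) :
    OpenPartialHomeomorph N14 (EuclideanSpace ℂ (Fin 7)) where
  toFun := coneMap θ σ
  invFun := coneInv σ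
  source := coneSource θ σ
  target := coneTarget θ σ
  map_source' p hp := by
    refine ⟨coneMap_zero_ne hp, ?_⟩
    rw [Set.mem_preimage, norm_coneReal_coneMap (coneMap_zero_ne hp), Real.log_exp]
    exact abs_argBranch_sub_lt hp.1
  map_target' c hc := by
    refine ⟨exp_mul_inv_mem_slitPlane hc.2, ?_⟩
    have h0 : 0 < ‖coneReal σ c‖ := norm_pos_iff.2 (coneReal_ne_zero σ hc.1)
    rw [psiMap_coneInv σ hc.1, map_smul, PiLp.smul_apply]
    refine smul_ne_zero (inv_pos.2 h0).ne' ?_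
    change coneCoord σ (toCplx (coneReal σ c)) 0 ≠ 0
    rw [toCplx_coneReal, coneCoord_conePoint]
    exact hc.1
  left_inv' p hp := coneInv_coneMap (coneMap_zero_ne hp)
  right_inv' c hc := by
    rw [coneMap_coneInv θ σ σ hc.1, argBranch_exp hc.2, sub_self, Real.exp_zero, one_smul,
      coneCoord_conePoint]
  open_source := isOpen_coneSource θ σ
  open_target := isOpen_coneTarget θ σ
  continuousOn_toFun p hp :=
    (contMDiffAt_coneMap (n := 0) σ hp.1).continuousAt.continuousWithinAt
  continuousOn_invFun c hc := (contMDiffAt_coneInv (n := 0) σ hc.1).continuousAt.continuousWithinAt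

lemma exists_mem_coneSource (p : N14) : ∃ σ, p ∈ coneSource (Complex.arg p.1) σ := by
  have h : toCplx (psiMap p.2) ≠ 0 := by
    rw [Ne, toCplx.map_eq_zero_iff, ← norm_eq_zero, norm_psiMap]
    exact one_ne_zero
  obtain ⟨σ, hσ⟩ := exists_coneCoord_ne_zero h
  refine ⟨σ, ?_, hσ⟩
  -- Centring the branch at the argument of the point itself rotates that point to `1`, away from
  -- the cut.
  rw [Circle.exp_arg, mul_inv_cancel, Circle.coe_one]
  exact Complex.one_mem_slitPlane

/-- Two continuous choices of argument differ locally by a constant. -/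
lemma eventually_argBranch_sub_eq {X : Type*} [TopologicalSpace X] {s : X → ℝ} {x : X} {θ : ℝ}
    (hs : ContinuousAt s x)
    (hx : ((Circle.exp (s x) * (Circle.exp θ)⁻¹ : Circle) : ℂ) ∈ Complex.slitPlane) :
    ∀ᶠ y in nhds x,
      argBranch θ (Circle.exp (s y)) - s y = argBranch θ (Circle.exp (s x)) - s x := by
  let δ : X → ℝ := fun y ↦ argBranch θ (Circle.exp (s y)) - s y
  have hδ : ContinuousAt δ x := by
    refine ContinuousAt.sub ?_ hs
    exact ContinuousAt.comp (g := argBranch θ) (f := fun y ↦ Circle.exp (s y))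
      (contMDiffAt_argBranch (m := 0) hx).continuousAt
      (Circle.exp.continuous.continuousAt.comp hs)
  -- So `δ` takes values in `2πℤ`, and continuity keeps it within less than `2π` of `δ x`.
  have hexp : ∀ y, Circle.exp (δ y) = 1 := fun y ↦ by
    rw [Circle.exp_sub, exp_argBranch, div_self']
  have h1 := Metric.continuousAt_iff'.1 hδ (2 * Real.pi) Real.two_pi_pos
  filter_upwards [h1] with y hy
  have h2 : Circle.exp (δ y) = Circle.exp (δ x) := by rw [hexp, hexp]
  rw [Circle.exp_eq_exp] at h2
  obtain ⟨m, hm⟩ := h2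
  have h3 : m = 0 := by
    rw [Real.dist_eq, hm, add_sub_cancel_left, abs_mul, abs_of_pos Real.two_pi_pos] at hy
    have h4 : |(m : ℝ)| < 1 := by
      by_contra! h5
      nlinarith [Real.two_pi_pos]
    have h5 : |m| < 1 := by exact_mod_cast h4
    exact Int.abs_lt_one_iff.1 h5
  change δ y = δ x
  rw [hm, h3]
  simp

/-- The dependence on `log ‖·‖`, which is not holomorphic, enters only through the mismatch of
branches. That mismatch is locally constant, so locally the transition is a constant multiple of a
holomorphic coordinate change of the cone. -/
lemma contDiffOn_coneChart_transition (θ θ' : ℝ) (σ σ' : Equiv.Perm (Fin 8)) :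
    ContDiffOn ℂ ω (coneMap θ' σ' ∘ coneInv σ)
      ((coneChart θ σ).symm.trans (coneChart θ' σ')).source := by
  intro c hc
  have hc1 : c ∈ coneTarget θ σ := hc.1
  have hc2 : coneInv σ c ∈ coneSource θ' σ' := hc.2
  have h0 := (continuousOn_log_norm_coneReal σ).continuousAt (isOpen_coord_zero_ne.mem_nhds hc1.1)
  have h1 := eventually_argBranch_sub_eq h0 hc2.1
  refine ContDiffAt.contDiffWithinAt ?_
  have h2 : ContDiffAt ℂ ω (fun d ↦ Real.exp (argBranch θ' (Circle.exp (Real.log ‖coneReal σ c‖)) -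
      Real.log ‖coneReal σ c‖) • coneCoord σ' (conePoint σ d)) c :=
    ((coneCoord σ').contDiff.contDiffAt.comp c (contDiffAt_conePoint σ hc1.1)).const_smul _
  refine h2.congr_of_eventuallyEq ?_
  filter_upwards [h1, isOpen_coord_zero_ne.mem_nhds hc1.1] with d hd hd0
  rw [Function.comp_apply, coneMap_coneInv θ' σ σ' hd0, hd]

/-- The charted space structure of `S¹ × S⁷ × S⁶` given by the charts `coneChart`. -/
@[reducible]
def coneChartedSpace : ChartedSpace (EuclideanSpace ℂ (Fin 7)) N14 where
  atlas := Set.range fun q : ℝ × Equiv.Perm (Fin 8) ↦ coneChart q.1 q.2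
  chartAt p := coneChart (Complex.arg p.1) (exists_mem_coneSource p).choose
  mem_chart_source p := (exists_mem_coneSource p).choose_spec
  chart_mem_atlas p := ⟨(Complex.arg p.1, (exists_mem_coneSource p).choose), rfl⟩

/-- The complex structure of `S¹ × S⁷ × S⁶`. -/
def coneStructure : ComplexStructure modelN14 N14 7 where
  toChartedSpace := coneChartedSpace
  holomorphic := by
    let := coneChartedSpace
    refine isManifold_of_contDiffOn _ _ _ ?_
    rintro _ _ ⟨⟨θ, σ⟩, rfl⟩ ⟨⟨θ', σ'⟩, rfl⟩
    refine (contDiffOn_coneChart_transition θ θ' σ σ').congr_mono (fun _ _ ↦ rfl) ?_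
    exact fun _ h ↦ h.1
  smooth_chart := by
    rintro _ ⟨⟨θ, σ⟩, rfl⟩ p hp
    exact (contMDiffAt_coneMap σ hp.1).contMDiffWithinAt
  smooth_chart_symm := by
    rintro _ ⟨⟨θ, σ⟩, rfl⟩ c hc
    exact (contMDiffAt_coneInv σ hc.1).contMDiffWithinAt

/-! ### Polar coordinates carry multiplication by `i` to `J` -/

lemma etaField_add (x y : R16) : etaField (x + y) = etaField x + etaField y := by
  apply toCplx.injective
  rw [map_add, toCplx_etaField, toCplx_etaField, toCplx_etaField, map_add, smul_add]

lemma etaField_smul (r : ℝ) (x : R16) : etaField (r • x) = r • etaField x := by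
  apply toCplx.injective
  rw [map_smul, toCplx_etaField, toCplx_etaField, map_smul, smul_comm]

lemma etaField_sub (x y : R16) : etaField (x - y) = etaField x - etaField y := by
  rw [sub_eq_add_neg, ← neg_one_smul ℝ y, etaField_add, etaField_smul, neg_one_smul,
    ← sub_eq_add_neg]

lemma etaField_etaField (x : R16) : etaField (etaField x) = -x := by
  apply toCplx.injective
  rw [toCplx_etaField, toCplx_etaField, smul_smul, Complex.I_mul_I, neg_one_smul, map_neg]

lemma inner_etaField_left (x y : R16) : ⟪etaField x, y⟫ = -⟪x, etaField y⟫ := by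
  simp [etaField, cliffP0, cliffP1, WithLp.prod_inner_apply]

lemma inner_self_etaField (x : R16) : ⟪x, etaField x⟫ = 0 := by
  have h := inner_etaField_left x x
  rw [real_inner_comm] at h
  linarith

lemma focalJ_eq (q w : ℂ × R16) :
    focalJ q w = (-(⟪w.2, etaField q.2⟫ • epsField q.1),
      ⟪w.1, epsField q.1⟫ • etaField q.2 + etaField (w.2 - ⟪w.2, etaField q.2⟫ • etaField q.2)) :=
  rfl

lemma inner_smul_epsField_self (s : ℝ) {a : ℂ} (ha : ‖a‖ = 1) :
    ⟪s • epsField a, epsField a⟫ = s := by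
  rw [inner_smul_left, real_inner_self_eq_norm_sq, epsField, norm_mul, ha]
  simp

section Polar
variable {V : Type*} [NormedAddCommGroup V] [InnerProductSpace ℝ V]

/-- The polar decomposition `x ↦ (|x|ⁱ, x / |x|)`. -/
def polarMap (x : V) : ℂ × V :=
  (Complex.exp (Real.log ‖x‖ * Complex.I), Real.exp (-Real.log ‖x‖) • x)

lemma hasFDerivAt_log_norm {x : V} (hx : x ≠ 0) :
    HasFDerivAt (fun y : V ↦ Real.log ‖y‖) ((‖x‖ ^ 2)⁻¹ • innerSL ℝ x) x := by
  have h1 : HasFDerivAt (fun y : V ↦ ‖y‖ ^ 2) (2 • innerSL ℝ x) x :=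
    (hasStrictFDerivAt_norm_sq x).hasFDerivAt
  have h2 := (h1.log (pow_ne_zero 2 (norm_ne_zero_iff.2 hx))).const_mul (1 / 2 : ℝ)
  -- The squared norm has a ready derivative, and halving its logarithm recovers `log ‖y‖`.
  have h3 : (fun y : V ↦ Real.log ‖y‖) = fun y ↦ 1 / 2 * Real.log (‖y‖ ^ 2) := by
    ext y
    rw [Real.log_pow]
    push_cast
    ring
  rw [h3]
  refine h2.congr_fderiv ?_
  ext h
  simp
  ring

lemma differentiableAt_polarMap {x : V} (hx : x ≠ 0) : DifferentiableAt ℝ polarMap x := by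
  have h := (hasFDerivAt_log_norm hx).differentiableAt
  refine DifferentiableAt.prodMk ?_ (h.neg.exp.smul differentiableAt_id)
  exact ((Complex.ofRealCLM.differentiableAt.comp x h).mul_const _).cexp

lemma fderiv_polarMap_apply {x : V} (hx : x ≠ 0) (h : V) :
    fderiv ℝ polarMap x h =
      (((‖x‖ ^ 2)⁻¹ * ⟪x, h⟫) • epsField (polarMap x).1,
        Real.exp (-Real.log ‖x‖) • (h - ((‖x‖ ^ 2)⁻¹ * ⟪x, h⟫) • x)) := by
  have hl := hasFDerivAt_log_norm hx
  have h1 : HasFDerivAt (fun y : V ↦ Complex.exp (Real.log ‖y‖ * Complex.I)) _ x :=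
    ((Complex.ofRealCLM.hasFDerivAt.comp x hl).mul_const Complex.I).cexp
  have h2 := hl.neg.exp.smul (hasFDerivAt_id x)
  have h3 : HasFDerivAt polarMap _ x := h1.prodMk h2
  rw [h3.fderiv]
  refine Prod.ext ?_ ?_
  · simp [epsField, polarMap]
    ring
  · simp [smul_sub, smul_smul]
    module

end Polar

/-- Skewness of `P₀ P₁` exchanges the `x` and `P₀ P₁ x` components of `h`, matching the exchange of
`ε` and `η` by `J`; on the rest both sides apply `P₀ P₁`. Tangency of `h` to the cone plays no role,
since `focalJ` is given by a formula on all of `ℂ × ℝ¹⁶`. -/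
lemma fderiv_polarMap_etaField {x : R16} (hx : x ≠ 0) (h : R16) :
    fderiv ℝ polarMap x (etaField h) = focalJ (polarMap x) (fderiv ℝ polarMap x h) := by
  have ha : ‖(polarMap x).1‖ = 1 := Complex.norm_exp_ofReal_mul_I _
  have hr : 0 < ‖x‖ := norm_pos_iff.2 hx
  rw [focalJ_eq, fderiv_polarMap_apply hx, fderiv_polarMap_apply hx]
  dsimp only
  rw [inner_smul_epsField_self _ ha]
  have e2 : (polarMap x).2 = ‖x‖⁻¹ • x := by
    rw [polarMap, Real.exp_neg, Real.exp_log hr]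
  have e3 : Real.exp (-Real.log ‖x‖) = ‖x‖⁻¹ := by
    rw [Real.exp_neg, Real.exp_log hr]
  have e4 : ⟪x, etaField h⟫ = -⟪h, etaField x⟫ := by
    rw [real_inner_comm, inner_etaField_left]
  rw [e2, e3, e4]
  simp only [etaField_smul, etaField_sub, etaField_etaField, inner_smul_left, inner_smul_right,
    inner_sub_left, inner_self_etaField, conj_trivial]
  refine Prod.ext ?_ ?_ <;> dsimp only
  · rw [← neg_smul]
    congr 1
    field_simp
    ring
  · simp only [smul_sub, smul_smul, smul_neg, sub_neg_eq_add]
    module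

lemma mdifferentiableAt_coneInv (σ : Equiv.Perm (Fin 8)) {c : EuclideanSpace ℂ (Fin 7)}
    (hc : c 0 ≠ 0) :
    MDifferentiableAt 𝓘(ℝ, EuclideanSpace ℂ (Fin 7)) modelN14 (coneInv σ) c :=
  (contMDiffAt_coneInv (n := 1) σ hc).mdifferentiableAt one_ne_zero

lemma mdifferentiableAt_coneMap {θ : ℝ} {σ : Equiv.Perm (Fin 8)} {p : N14}
    (hp : p ∈ coneSource θ σ) :
    MDifferentiableAt modelN14 𝓘(ℝ, EuclideanSpace ℂ (Fin 7)) (coneMap θ σ) p :=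
  (contMDiffAt_coneMap (n := 1) σ hp.1).mdifferentiableAt one_ne_zero

lemma mdifferentiableAt_bigPsi (p : N14) :
    MDifferentiableAt modelN14 𝓘(ℝ, ℂ × R16) bigPsi p := by
  have h1 : ContMDiffAt modelN14 𝓘(ℝ, ℂ) 1 (fun p : N14 ↦ (p.1 : ℂ)) p :=
    ContMDiffAt.comp (g := fun a : Circle ↦ (a : ℂ)) (f := fun p : N14 ↦ p.1) p
      contMDiff_coe_circle.contMDiffAt contMDiffAt_fst
  have h2 : ContMDiffAt modelN14 𝓘(ℝ, R16) 1 (fun p : N14 ↦ psiMap p.2) p :=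
    ContMDiffAt.comp (g := psiMap) (f := fun p : N14 ↦ p.2) p
      contMDiff_psiMap.contMDiffAt contMDiffAt_snd
  exact (h1.prodMk_space h2).mdifferentiableAt one_ne_zero

/-! ### The induced almost complex structure and its pullback description -/

section Differential
variable {E E' H M : Type*} [NormedAddCommGroup E] [NormedSpace ℝ E] [NormedAddCommGroup E']
  [NormedSpace ℝ E'] [TopologicalSpace H] {I : ModelWithCorners ℝ E H} [TopologicalSpace M]
  [ChartedSpace H M]

variable (I) in
/-- The differential at `c` of a map to a manifold with `f c = p`. -/
def mfderivTo (f : E' → M) (c : E') (p : M) : E' →L[ℝ] TangentSpace I p := mfderiv 𝓘(ℝ, E') I f c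

variable (I) in
/-- The differential at `p` of a map to a vector space. -/
def mfderivFrom (g : M → E') (p : M) : TangentSpace I p →L[ℝ] E' := mfderiv I 𝓘(ℝ, E') g p

/-- Chain rule with the base point `p` kept separate from `f c`, so that later rewriting needs no
transport between tangent spaces. -/
lemma mfderivFrom_mfderivTo {E'' : Type*} [NormedAddCommGroup E''] [NormedSpace ℝ E'']
    {f : E' → M} {g : M → E''} {c : E'} {p : M} (hg : MDifferentiableAt I 𝓘(ℝ, E'') g p)
    (hf : MDifferentiableAt 𝓘(ℝ, E') I f c) (h : f c = p) (k : E') :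
    mfderivFrom I g p (mfderivTo I f c p k) = fderiv ℝ (g ∘ f) c k := by
  subst h
  have h1 := mfderiv_comp_apply c hg hf k
  rw [mfderiv_eq_fderiv] at h1
  exact h1.symm

lemma mfderivTo_mfderivFrom {f : E' → M} {g : M → E'} {p : M}
    (hg : MDifferentiableAt I 𝓘(ℝ, E') g p) (hf : MDifferentiableAt 𝓘(ℝ, E') I f (g p))
    (h : f ∘ g =ᶠ[nhds p] id) (v : TangentSpace I p) :
    mfderivTo I f (g p) p (mfderivFrom I g p v) = v := by
  have h1 := mfderiv_comp_apply p hf hg v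
  rw [h.mfderiv_eq, mfderiv_id] at h1
  exact h1.symm

end Differential

/-- The differential of the chart `coneChart θ σ` at `p`. -/
def coneDeriv (θ : ℝ) (σ : Equiv.Perm (Fin 8)) (p : N14) :
    TangentSpace modelN14 p →L[ℝ] EuclideanSpace ℂ (Fin 7) :=
  mfderivFrom modelN14 (coneMap θ σ) p

/-- The differential of the inverse of the chart `coneChart θ σ` at the image of `p`. -/
def coneInvDeriv (θ : ℝ) (σ : Equiv.Perm (Fin 8)) (p : N14) :
    EuclideanSpace ℂ (Fin 7) →L[ℝ] TangentSpace modelN14 p :=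
  mfderivTo modelN14 (coneInv σ) (coneMap θ σ p) p

lemma coneInvDeriv_coneDeriv {θ : ℝ} {σ : Equiv.Perm (Fin 8)} {p : N14}
    (hp : p ∈ coneSource θ σ) (v : TangentSpace modelN14 p) :
    coneInvDeriv θ σ p (coneDeriv θ σ p v) = v := by
  have h1 : coneInv σ ∘ coneMap θ σ =ᶠ[nhds p] id := by
    filter_upwards [(isOpen_coneSource θ σ).mem_nhds hp] with q hq
    exact coneInv_coneMap (coneMap_zero_ne hq)
  exact mfderivTo_mfderivFrom (mdifferentiableAt_coneMap hp)
    (mdifferentiableAt_coneInv σ (coneMap_zero_ne hp)) h1 v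

lemma fderiv_real_comp_apply {E F V : Type*} [NormedAddCommGroup E] [NormedSpace ℂ E]
    [NormedSpace ℝ E] [IsScalarTower ℝ ℂ E] [NormedAddCommGroup F] [NormedSpace ℂ F]
    [NormedSpace ℝ F] [IsScalarTower ℝ ℂ F] [NormedAddCommGroup V] [NormedSpace ℝ V]
    (T : F →L[ℝ] V) {f : E → F} {x : E} (hf : DifferentiableAt ℂ f x) (h : E) :
    fderiv ℝ (fun y ↦ T (f y)) x h = T (fderiv ℂ f x h) := by
  have h1 : HasFDerivAt (fun y ↦ T (f y)) (T.comp ((fderiv ℂ f x).restrictScalars ℝ)) x :=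
    T.hasFDerivAt.comp x (hf.hasFDerivAt.restrictScalars ℝ)
  rw [h1.fderiv]
  rfl

lemma fderiv_real_apply {E F : Type*} [NormedAddCommGroup E] [NormedSpace ℂ E]
    [NormedSpace ℝ E] [IsScalarTower ℝ ℂ E] [NormedAddCommGroup F] [NormedSpace ℂ F]
    [NormedSpace ℝ F] [IsScalarTower ℝ ℂ F] {f : E → F} {x : E} (hf : DifferentiableAt ℂ f x)
    (h : E) : fderiv ℝ f x h = fderiv ℂ f x h :=
  fderiv_real_comp_apply (ContinuousLinearMap.id ℝ F) hf h

lemma differentiableAt_coneChart_transition {θ θ' : ℝ} {σ σ' : Equiv.Perm (Fin 8)} {p : N14}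
    (hp : p ∈ coneSource θ σ) (hp' : p ∈ coneSource θ' σ') :
    DifferentiableAt ℂ (coneMap θ' σ' ∘ coneInv σ) (coneMap θ σ p) := by
  have hsrc : coneMap θ σ p ∈ ((coneChart θ σ).symm.trans (coneChart θ' σ')).source := by
    rw [OpenPartialHomeomorph.trans_source]
    refine ⟨(coneChart θ σ).map_source hp, ?_⟩
    rw [Set.mem_preimage]
    change coneInv σ (coneMap θ σ p) ∈ coneSource θ' σ'
    rwa [coneInv_coneMap (coneMap_zero_ne hp)]
  have h1 := (contDiffOn_coneChart_transition θ θ' σ σ').contDiffAt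
    (((coneChart θ σ).symm.trans (coneChart θ' σ')).open_source.mem_nhds hsrc)
  exact h1.differentiableAt (by simp)

lemma coneDeriv_coneInvDeriv {θ θ' : ℝ} {σ σ' : Equiv.Perm (Fin 8)} {p : N14}
    (hp : p ∈ coneSource θ σ) (hp' : p ∈ coneSource θ' σ') (k : EuclideanSpace ℂ (Fin 7)) :
    coneDeriv θ' σ' p (coneInvDeriv θ σ p k) =
      fderiv ℝ (coneMap θ' σ' ∘ coneInv σ) (coneMap θ σ p) k :=
  mfderivFrom_mfderivTo (mdifferentiableAt_coneMap hp')
    (mdifferentiableAt_coneInv σ (coneMap_zero_ne hp)) (coneInv_coneMap (coneMap_zero_ne hp)) k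

/-- Differentials of holomorphic transitions commute with `i`; hence `coneJ`, built from one chosen
chart at each point, is multiplication by `i` in every chart. -/
lemma coneDeriv_coneInvDeriv_I_smul {θ θ' : ℝ} {σ σ' : Equiv.Perm (Fin 8)} {p : N14}
    (hp : p ∈ coneSource θ σ) (hp' : p ∈ coneSource θ' σ') (h : EuclideanSpace ℂ (Fin 7)) :
    coneDeriv θ' σ' p (coneInvDeriv θ σ p (Complex.I • h)) =
      Complex.I • coneDeriv θ' σ' p (coneInvDeriv θ σ p h) := by
  have hd := differentiableAt_coneChart_transition hp hp'
  rw [coneDeriv_coneInvDeriv hp hp', coneDeriv_coneInvDeriv hp hp', fderiv_real_apply hd,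
    fderiv_real_apply hd, map_smul]

/-- No branch of the argument appears here: the chart inverses are all restrictions of the one
quotient map of the cone, read in coordinates. -/
lemma bigPsi_coneInv (σ : Equiv.Perm (Fin 8)) {c : EuclideanSpace ℂ (Fin 7)} (hc : c 0 ≠ 0) :
    bigPsi (coneInv σ c) = polarMap (coneReal σ c) := by
  refine Prod.ext ?_ ?_
  · exact Circle.coe_exp _
  · change psiMap (coneInv σ c).2 = Real.exp (-Real.log ‖coneReal σ c‖) • coneReal σ c
    rw [psiMap_coneInv σ hc, Real.exp_neg,
      Real.exp_log (norm_pos_iff.2 (coneReal_ne_zero σ hc))]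

lemma fderiv_coneReal_I_smul (σ : Equiv.Perm (Fin 8)) {c : EuclideanSpace ℂ (Fin 7)}
    (hc : c 0 ≠ 0) (h : EuclideanSpace ℂ (Fin 7)) :
    fderiv ℝ (coneReal σ) c (Complex.I • h) = etaField (fderiv ℝ (coneReal σ) c h) := by
  have h1 (k : EuclideanSpace ℂ (Fin 7)) :
      fderiv ℝ (coneReal σ) c k = toCplx.symm (fderiv ℂ (conePoint σ) c k) :=
    fderiv_real_comp_apply (toCplx.symm : EuclideanSpace ℂ (Fin 8) →L[ℝ] R16)
      ((contDiffAt_conePoint σ (n := 1) hc).differentiableAt one_ne_zero) k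
  rw [h1, h1, map_smul, toCplx_symm_I_smul]

lemma mfderivFrom_bigPsi_coneInvDeriv {θ : ℝ} {σ : Equiv.Perm (Fin 8)} {p : N14}
    (hp : p ∈ coneSource θ σ) (h : EuclideanSpace ℂ (Fin 7)) :
    mfderivFrom modelN14 bigPsi p (coneInvDeriv θ σ p h) =
    fderiv ℝ polarMap (coneReal σ (coneMap θ σ p)) (fderiv ℝ (coneReal σ) (coneMap θ σ p) h) := by
  have hc := coneMap_zero_ne hp
  have h1 : bigPsi ∘ coneInv σ =ᶠ[nhds (coneMap θ σ p)] polarMap ∘ coneReal σ := by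
    filter_upwards [isOpen_coord_zero_ne.mem_nhds hc] with d hd
    exact bigPsi_coneInv σ hd
  refine (mfderivFrom_mfderivTo (mdifferentiableAt_bigPsi p)
    (mdifferentiableAt_coneInv σ hc) (coneInv_coneMap hc) h).trans ?_
  rw [h1.fderiv_eq, fderiv_comp _ (differentiableAt_polarMap (coneReal_ne_zero σ hc))
    ((contDiffAt_coneReal σ (n := 1) hc).differentiableAt one_ne_zero)]
  rfl

/-- Multiplication by `i` on `ℂ⁷`, as a real linear map. -/
def mulI : EuclideanSpace ℂ (Fin 7) →L[ℝ] EuclideanSpace ℂ (Fin 7) :=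
  (Complex.I • ContinuousLinearMap.id ℂ (EuclideanSpace ℂ (Fin 7))).restrictScalars ℝ

/-- A choice of coordinates of the cone near a point. -/
def coneIndex (p : N14) : Equiv.Perm (Fin 8) := (exists_mem_coneSource p).choose

lemma mem_coneSource_coneIndex (p : N14) : p ∈ coneSource (Complex.arg p.1) (coneIndex p) :=
  (exists_mem_coneSource p).choose_spec

/-- The almost complex structure of `coneStructure`. -/
def coneJ (p : N14) : TangentSpace modelN14 p →L[ℝ] TangentSpace modelN14 p :=
  (coneInvDeriv (Complex.arg p.1) (coneIndex p) p).comp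
    (mulI.comp (coneDeriv (Complex.arg p.1) (coneIndex p) p))

lemma coneJ_apply (p : N14) (v : TangentSpace modelN14 p) :
    coneJ p v = coneInvDeriv (Complex.arg p.1) (coneIndex p) p
      (Complex.I • coneDeriv (Complex.arg p.1) (coneIndex p) p v) := rfl

lemma coneDeriv_coneJ {θ : ℝ} {σ : Equiv.Perm (Fin 8)} {p : N14} (hp : p ∈ coneSource θ σ)
    (v : TangentSpace modelN14 p) :
    coneDeriv θ σ p (coneJ p v) = Complex.I • coneDeriv θ σ p v := by
  have hp0 := mem_coneSource_coneIndex p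
  rw [coneJ_apply, coneDeriv_coneInvDeriv_I_smul hp0 hp, coneInvDeriv_coneDeriv hp0]

lemma coneStructure_induces : coneStructure.Induces coneJ := by
  rintro _ ⟨⟨θ, σ⟩, rfl⟩ p hp
  exact fun v ↦ coneDeriv_coneJ (θ := θ) (σ := σ) hp v

/-- In a chart, `Ψ` is `polarMap` after the holomorphic parametrisation `coneReal`. The latter turns
`i` into `P₀ P₁`, and `polarMap` turns `P₀ P₁` into `J`. -/
lemma mfderivFrom_bigPsi_coneJ (p : N14) (w : TangentSpace modelN14 p) :
    mfderivFrom modelN14 bigPsi p (coneJ p w) =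
      focalJ (bigPsi p) (mfderivFrom modelN14 bigPsi p w) := by
  have hp := mem_coneSource_coneIndex p
  have hc := coneMap_zero_ne hp
  have h1 := mfderivFrom_bigPsi_coneInvDeriv hp (coneDeriv (Complex.arg p.1) (coneIndex p) p w)
  rw [coneInvDeriv_coneDeriv hp] at h1
  rw [h1, coneJ_apply]
  refine (mfderivFrom_bigPsi_coneInvDeriv hp _).trans ?_
  rw [fderiv_coneReal_I_smul _ hc, fderiv_polarMap_etaField (coneReal_ne_zero _ hc),
    ← bigPsi_coneInv _ hc, coneInv_coneMap hc]

end

theorem corollary2 :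
    -- `ψ` is a diffeomorphism of `S⁷ × S⁶` onto the submanifold `M₊` of `ℝ¹⁶`
    (Manifold.IsSmoothEmbedding modelS7S6 𝓘(ℝ, R16) ∞ psiMap ∧ Set.range psiMap = MPlus) ∧
    -- `S¹ × S⁷ × S⁶` has a complex structure, and the almost complex structure that it induces
    -- is the pullback under `Ψ = id × ψ` of `J` on `S¹ × M₊`
    ∃ (C : ComplexStructure modelN14 N14 7)
      (J : ∀ p : N14, TangentSpace modelN14 p →L[ℝ] TangentSpace modelN14 p),
      C.Induces J ∧
      ∀ (p : N14) (w : TangentSpace modelN14 p),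
        (mfderiv modelN14 𝓘(ℝ, ℂ × R16) bigPsi p (J p w) : ℂ × R16) =
          focalJ (bigPsi p) (mfderiv modelN14 𝓘(ℝ, ℂ × R16) bigPsi p w : ℂ × R16) :=
  ⟨⟨isSmoothEmbedding_psiMap, range_psiMap⟩, coneStructure, coneJ, coneStructure_induces,
    mfderivFrom_bigPsi_coneJ⟩
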